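/- Let $K$ be a field of characteristic zero, let $n\ge 2$, and let $H$ be a polynomial map over $K$ of the form $$H=\big(H_1(x_1,x_2,\ldots,x_n),\,H_2(x_1,x_2),\,H_3(x_1,x_2),\ldots,H_n(x_1,x_2)\big)$$ (so $H_1\in K[x_1,\ldots,x_n]$ and $H_2,\ldots,H_n\in K[x_1,x_2]$) such that $H(0)=0$. If the Jacobian matrix $JH=(\partial H_i/\partial x_j)$ is nilpotent, then there exists a $T\in \mathrm{GL}_n(K)$ such that $\tilde H=T^{-1}H(Tx)$ has the same form as $H$ (i.e. $\tilde H_2,\ldots,\tilde H_n\in K[x_1,x_2]$), and one of the following statements holds: (i) $\tilde H_2=0$, and there exist a $k\in\{2,3,\ldots,n\}$ and an $A\in \mathrm{GL}_{n-2}(K[x_2])$ such that $\tilde H_1\in K[x_2,A_{k-1}\tilde x,A_k\tilde x,\ldots,A_{n-2}\tilde x]$, and the column vector with entries $\tilde H_i(x_1,x_2)-\tilde H_i(0,x_2)$, $i=3,4,\ldots,n$, is a $K[x_1,x_2]$-linear combination of the first $k-2$ columns of $A^{-1}$. Here $A_l$ denotes the $l$-th row of $A$, and $\tilde x=(x_3,x_4,\ldots,x_n)$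 as a column vector. (ii) $\tilde H_2\in K[x_1]\setminus K$, and there exists a $k\in\{2,3,\ldots,n\}$ such that $\tilde H_1\in K[x_{k+1},x_{k+2},\ldots,x_n]$ and $\tilde H_{k+1}=\tilde H_{k+2}=\cdots=\tilde H_n=0$. (iii) $n\ge 3$, $\tilde H_2\in K[x_1+x_2^2]$, $\tilde H_3=\tilde H_2^2$, and there exists a $k\in\{3,4,\ldots,n\}$ such that $\tilde H_1+2x_2\tilde H_2-x_3\in K[x_{k+1},x_{k+2},\ldots,x_n]$ and $\tilde H_{k+1}=\tilde H_{k+2}=\cdots=\tilde H_n=0$. For $k=n$, the algebras in (i), (ii) and (iii) are read as $K[x_2]$, $K$ and $K$ respectively, and the condition $\tilde H_{k+1}=\cdots=\tilde H_n=0$ is void. -/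

import Mathlib

/-!
Polynomial maps `K^n → K^n` with `n = m + 2`. Indices are shifted by one with respect to the
usual notation: `MvPolynomial.X i : MvPolynomial (Fin (m + 2)) K` is the variable `x_{i+1}`, and
`H i` is the component `H_{i+1}`.
-/

namespace PolyMap

open MvPolynomial

/-- A polynomial map `K^n → K^n`, given by its components. -/
abbrev Map (n : ℕ) (K : Type*) [CommSemiring K] := Fin n → MvPolynomial (Fin n) K

section General

variable {K : Type*} [Field K] {n : ℕ}

/-- The Jacobian matrix `(∂H_i / ∂x_j)`. -/
noncomputable def jacobian (H : Map n K) : Matrix (Fin n) (Fin n) (MvPolynomial (Fin n) K) :=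
  Matrix.of fun i j => pderiv j (H i)

/-- The linear conjugate `T⁻¹ H(T x)`. -/
noncomputable def conj (T : Matrix.GeneralLinearGroup (Fin n) K) (H : Map n K) : Map n K :=
  fun i => ∑ j, C ((T⁻¹).val i j) * aeval (fun l => ∑ s, C (T.val l s) * X s) (H j)

/-- The subalgebra `K[x_{k+1}, …, x_n]`. -/
noncomputable def tailAlg (K : Type*) [Field K] (n k : ℕ) :
    Subalgebra K (MvPolynomial (Fin n) K) :=
  Algebra.adjoin K {p | ∃ i : Fin n, k ≤ (i : ℕ) ∧ p = X i}

end General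

section Form

variable {K : Type*} [Field K] {m : ℕ}

/-- `H = (H_1(x_1, …, x_n), H_2(x_1, x_2), …, H_n(x_1, x_2))`. -/
def HasForm (H : Map (m + 2) K) : Prop :=
  ∀ i, i ≠ 0 → H i ∈ Algebra.adjoin K ({X 0, X 1} : Set (MvPolynomial (Fin (m + 2)) K))

/-- A univariate polynomial, read as a polynomial in the variable `x_2`. -/
noncomputable def inX2 (p : Polynomial K) : MvPolynomial (Fin (m + 2)) K :=
  Polynomial.aeval (X 1) p

/-- The substitution `x_1 = 0`. -/
noncomputable def atX1Zero (p : MvPolynomial (Fin (m + 2)) K) : MvPolynomial (Fin (m + 2)) K :=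
  aeval (fun i => if i = 0 then 0 else X i) p

/-- The row of index `l` (counted from `0`) of `A` over `K[x_2]`, times the column
`(x_3, …, x_n)`. -/
noncomputable def rowForm (A : Matrix (Fin m) (Fin m) (Polynomial K)) (l : Fin m) :
    MvPolynomial (Fin (m + 2)) K :=
  ∑ j, inX2 (A l j) * X j.succ.succ

/-- First normal form. Rows `k-1, …, n-2` of `A` (counted from `1`) are those of index `l` with
`k ≤ l + 2`, and the first `k-2` columns are those of index `j` with `j + 2 < k`. -/
def NormalFormI (H : Map (m + 2) K) : Prop :=
  H 1 = 0 ∧ ∃ k : ℕ, 2 ≤ k ∧ k ≤ m + 2 ∧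
    ∃ A : Matrix.GeneralLinearGroup (Fin m) (Polynomial K),
      H 0 ∈ Algebra.adjoin K
        (insert (X 1) {p | ∃ l : Fin m, k ≤ (l : ℕ) + 2 ∧ p = rowForm A.val l}) ∧
      ∃ c : Fin m → MvPolynomial (Fin (m + 2)) K,
        (∀ j, c j ∈ Algebra.adjoin K ({X 0, X 1} : Set (MvPolynomial (Fin (m + 2)) K))) ∧
        ∀ i : Fin m, H i.succ.succ - atX1Zero (H i.succ.succ) =
          ∑ j ∈ Finset.univ.filter (fun j : Fin m => (j : ℕ) + 2 < k), c j * inX2 ((A⁻¹).val i j)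

/-- Second normal form. -/
def NormalFormII (H : Map (m + 2) K) : Prop :=
  (H 1 ∈ Algebra.adjoin K ({X 0} : Set (MvPolynomial (Fin (m + 2)) K)) ∧
    ∀ a : K, H 1 ≠ C a) ∧
  ∃ k : ℕ, 2 ≤ k ∧ k ≤ m + 2 ∧ H 0 ∈ tailAlg K (m + 2) k ∧
    ∀ i : Fin (m + 2), k ≤ (i : ℕ) → H i = 0

/-- Third normal form; it requires `n ≥ 3`, and `⟨2, h⟩` is the index of `x_3` and `H_3`. -/
def NormalFormIII (H : Map (m + 2) K) : Prop :=
  H 1 ∈ Algebra.adjoin K ({X 0 + X 1 ^ 2} : Set (MvPolynomial (Fin (m + 2)) K)) ∧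
  ∃ h : 2 < m + 2, H ⟨2, h⟩ = H 1 ^ 2 ∧
    ∃ k : ℕ, 3 ≤ k ∧ k ≤ m + 2 ∧
      H 0 + 2 * X 1 * H 1 - X ⟨2, h⟩ ∈ tailAlg K (m + 2) k ∧
      ∀ i : Fin (m + 2), k ≤ (i : ℕ) → H i = 0

end Form

end PolyMap

/-! Below the first row the Jacobian matrix lives in its first two columns, so the traces of its
first three powers give three scalar equations (`nilpotent_equations`). Write `Q = H_2`.

If `∂Q/∂x_1 = 0`, they force `Q = 0`, `∂H_1/∂x_1 = 0` and `∑ ∂_i H_1 · ∂_1 H_i = 0`, summed over `i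
≥ 3`. This relation splits along the powers of `x_1`: the coefficient vectors of `(H_3, …, H_n)` at
positive powers of `x_1` lie in the `K[x_2]`-module of relations between the `∂_i H_1`. That module
is saturated over a PID, hence a direct summand, and a basis adapted to it gives form (i).

If `∂Q/∂x_1 ≠ 0`, read `V = (H_2, …, H_n)` as a vector field in `x_2, …, x_n`. The equations say
that the derivatives of `H_1` along `∂_1 V` and `∂_2 V` lie in `K[x_1, x_2]`. A Lie bracket argument
passes this property on to the constant coefficient vectors of `V` (`isBivariate_dir_coeff`). One of
them, normalised, is a direction `e_2 + u` with bivariate derivative `Z`; along the coefficient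
vectors of `H_i - u_i Q` the derivative of `H_1` is even constant. With `S = ∑ (H_i - u_i Q) ∂_i
H_1`, `x = x_1`, `y = x_2`, a system in two variables remains: `Z_x = -Q_yy`, `Q_y² + Q_x Z + S_x =
0`, `Q_x S_y = Q_y S_x`. By `bivariate_classification`, `Q_y = (β + α y) Q_x` and `S` is a quadratic
polynomial in `Q`. A linear change of variables removes `β` and `u`; then `α = 0` gives form (ii)
and `α ≠ 0` gives form (iii). -/

namespace PolyMap

/-! ### The differential system in two variables. -/

section Bivariate

open Polynomial

variable {K : Type*} [Field K]

/-- The coefficientwise derivative on `K[y][x]`. -/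
noncomputable def dCoeff : Derivation K K[X][X] K[X][X] :=
  Derivation.mk'
    ((PolynomialModule.equivPolynomialSelf (R := K[X])).toLinearMap.restrictScalars K ∘ₗ
      ((derivative' (R := K)).mapCoeffs).toLinearMap)
    (fun a b => by
      change PolynomialModule.equivPolynomialSelf ((derivative' (R := K)).mapCoeffs (a * b)) =
        a • PolynomialModule.equivPolynomialSelf ((derivative' (R := K)).mapCoeffs b) +
          b • PolynomialModule.equivPolynomialSelf ((derivative' (R := K)).mapCoeffs a)
      rw [Derivation.leibniz, map_add, map_smul, map_smul])

theorem coeff_dCoeff (p : K[X][X]) (n : ℕ) :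
    (dCoeff p).coeff n = derivative (p.coeff n) := rfl

@[simp]
theorem dCoeff_C (a : K[X]) : dCoeff (C a) = C (derivative a) := by
  ext1 n
  rw [coeff_dCoeff, coeff_C, coeff_C]
  split_ifs <;> simp

@[simp]
theorem dCoeff_X : dCoeff (X : K[X][X]) = 0 := by
  ext1 n
  rw [coeff_dCoeff, coeff_X]
  split_ifs <;> simp

theorem dCoeff_mul (p q : K[X][X]) : dCoeff (p * q) = dCoeff p * q + p * dCoeff q := by
  rw [Derivation.leibniz, smul_eq_mul, smul_eq_mul]
  ring

theorem dCoeff_derivative (p : K[X][X]) : dCoeff (derivative p) = derivative (dCoeff p) := by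
  ext1 n
  simp [coeff_dCoeff, coeff_derivative]

theorem natDegree_dCoeff_le (p : K[X][X]) : (dCoeff p).natDegree ≤ p.natDegree := by
  rw [natDegree_le_iff_coeff_eq_zero]
  intro N hN
  rw [coeff_dCoeff, coeff_eq_zero_of_natDegree_lt hN, derivative_zero]

variable [CharZero K]

theorem eq_C_C_of_derivative_eq_zero {p : K[X][X]} (hx : derivative p = 0) (hy : dCoeff p = 0) :
    ∃ a : K, p = C (C a) := by
  obtain ⟨a, rfl⟩ : ∃ a, p = C a :=
    ⟨_, eq_C_of_natDegree_eq_zero (derivative_eq_zero.1 hx)⟩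
  rw [dCoeff_C, C_eq_zero] at hy
  exact ⟨_, congrArg C (eq_C_of_natDegree_eq_zero (derivative_eq_zero.1 hy))⟩

/-- A system of differential equations in one variable that forces `q` to be constant. -/
theorem derivative_eq_zero_of_ode {q z σ : K[X]} {D : ℕ} (hq : q ≠ 0)
    (h1 : ((D + 1 : ℕ) : K[X]) * z = - derivative (derivative q))
    (h2 : ((2 * D + 1 : ℕ) : K[X]) * σ = -((derivative q) ^ 2 + D * q * z))
    (h3 : D * q * derivative σ = ((2 * D + 1 : ℕ) : K[X]) * derivative q * σ) :
    derivative q = 0 := by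
  have hlc : q.coeff q.natDegree ≠ 0 := by simpa using hq
  have key : ((D + 1 : ℕ) : K[X]) * (((2 * D + 1 : ℕ) : K[X]) * σ) =
      D * q * derivative (derivative q) - ((D + 1 : ℕ) : K[X]) * (derivative q) ^ 2 := by
    linear_combination ((D + 1 : ℕ) : K[X]) * h2 - D * q * h1
  suffices h : q.natDegree = 0 by
    rw [eq_C_of_natDegree_eq_zero h, derivative_C]
  -- If `N > 0`, the coefficient of degree `2N - 2` in `key` is `D N (N-1) - (D+1) N² = -N (N+D)`
  -- times the square of the leading coefficient, so `σ ≠ 0`, and `deg σ ≤ 2N`. Leading coefficients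
  -- in `h3` require `D · deg σ = (2D+1) N`, which is too large. Derivatives are multiplied by
  -- powers of `X` so that degrees do not drop.
  by_contra hN
  set N := q.natDegree with hNdef
  have c1 : ∀ p : K[X], (X * derivative p).coeff p.natDegree
      = p.natDegree * p.coeff p.natDegree := by
    intro p
    rcases Nat.eq_zero_or_pos p.natDegree with h | h
    · rw [h]; simp
    · obtain ⟨k, hk⟩ : ∃ k, p.natDegree = k + 1 := ⟨_, (Nat.succ_pred_eq_of_pos h).symm⟩
      rw [hk, coeff_X_mul, coeff_derivative]
      push_cast; ring
  have d1 : ∀ p : K[X], (X * derivative p).natDegree ≤ p.natDegree := by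
    intro p
    rcases Nat.eq_zero_or_pos p.natDegree with h | h
    · rw [eq_C_of_natDegree_eq_zero h]; simp
    · refine natDegree_mul_le.trans ?_
      rw [natDegree_X]
      have := natDegree_derivative_lt h.ne'
      omega
  have c2 : (X ^ 2 * derivative (derivative q)).coeff N = N * (N - 1) * q.coeff N := by
    have e : X ^ 2 * derivative (derivative q) =
        X * derivative (X * derivative q) - X * derivative q := by
      rw [derivative_mul, derivative_X]; ring
    rw [e, coeff_sub, c1 q]
    obtain ⟨k, hk⟩ : ∃ k, N = k + 1 := ⟨_, (Nat.succ_pred_eq_of_ne_zero hN).symm⟩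
    have : (X * derivative (X * derivative q)).coeff N =
        (N : K) * (X * derivative q).coeff N := by
      rw [hk, coeff_X_mul, coeff_derivative]
      push_cast; ring
    rw [this, c1 q]
    ring
  have d2 : (X ^ 2 * derivative (derivative q)).natDegree ≤ N := by
    have e : X ^ 2 * derivative (derivative q) =
        X * derivative (X * derivative q) - X * derivative q := by
      rw [derivative_mul, derivative_X]; ring
    rw [e]
    exact (natDegree_sub_le _ _).trans (max_le ((d1 _).trans (d1 q)) (d1 q))
  have hDN : ∀ n : ℕ, (n : K[X]) = C (n : K) := fun n => (map_natCast C n).symm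
  have e1 : X ^ 2 * (((D + 1 : ℕ) : K[X]) * (((2 * D + 1 : ℕ) : K[X]) * σ)) =
      C (D : K) * (q * (X ^ 2 * derivative (derivative q))) -
        C ((D + 1 : ℕ) : K) * ((X * derivative q) * (X * derivative q)) := by
    rw [key, ← hDN, ← hDN]; ring
  have hcoef : (C (D : K) * (q * (X ^ 2 * derivative (derivative q))) -
        C ((D + 1 : ℕ) : K) * ((X * derivative q) * (X * derivative q))).coeff (N + N) =
      - ((N * (N + D) : ℕ) : K) * (q.coeff N) ^ 2 := by
    rw [coeff_sub, coeff_C_mul, coeff_C_mul, coeff_mul_add_eq_of_natDegree_le le_rfl d2,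
      coeff_mul_add_eq_of_natDegree_le (d1 q) (d1 q), c2, c1 q]
    push_cast; ring
  have hdeg : (C (D : K) * (q * (X ^ 2 * derivative (derivative q))) -
        C ((D + 1 : ℕ) : K) * ((X * derivative q) * (X * derivative q))).natDegree ≤ N + N := by
    refine (natDegree_sub_le _ _).trans (max_le ?_ ?_)
    · exact (natDegree_C_mul_le _ _).trans (natDegree_mul_le.trans (add_le_add le_rfl d2))
    · exact (natDegree_C_mul_le _ _).trans (natDegree_mul_le.trans (add_le_add (d1 q) (d1 q)))
  have hne : - ((N * (N + D) : ℕ) : K) * (q.coeff N) ^ 2 ≠ 0 := by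
    refine mul_ne_zero (neg_ne_zero.2 (Nat.cast_ne_zero.2 ?_)) (pow_ne_zero _ hlc)
    exact Nat.mul_ne_zero hN (by omega)
  have hσ : σ ≠ 0 := by
    rintro rfl
    rw [mul_zero, mul_zero, mul_zero] at e1
    rw [← e1] at hcoef
    exact hne (by rw [← hcoef]; simp)
  have hσdeg : σ.natDegree ≤ N + N := by
    have h4 : X ^ 2 * (((D + 1 : ℕ) : K[X]) * (((2 * D + 1 : ℕ) : K[X]) * σ)) =
        C (((D + 1) * (2 * D + 1) : ℕ) : K) * (X ^ 2 * σ) := by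
      rw [← hDN]; push_cast; ring
    rw [← e1, h4, natDegree_C_mul (Nat.cast_ne_zero.2 (by positivity)),
      natDegree_X_pow_mul _ hσ] at hdeg
    omega
  have hlcσ : σ.coeff σ.natDegree ≠ 0 := by simpa using hσ
  have e2 : C (D : K) * (q * (X * derivative σ)) =
      C ((2 * D + 1 : ℕ) : K) * ((X * derivative q) * σ) := by
    rw [← hDN, ← hDN]; linear_combination X * h3
  have e3 := congrArg (fun p => p.coeff (N + σ.natDegree)) e2
  simp only [coeff_C_mul] at e3
  rw [coeff_mul_add_eq_of_natDegree_le le_rfl (d1 σ), coeff_mul_add_eq_of_natDegree_le (d1 q) le_rfl,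
    c1, c1] at e3
  have e4 : ((D * σ.natDegree : ℕ) : K) = ((2 * D + 1) * N : ℕ) := by
    have : (q.coeff N * σ.coeff σ.natDegree) ≠ 0 := mul_ne_zero hlc hlcσ
    refine mul_right_cancel₀ this ?_
    push_cast at e3 ⊢
    linear_combination e3
  have e5 : D * σ.natDegree = (2 * D + 1) * N := by exact_mod_cast e4
  have := Nat.mul_le_mul_left D hσdeg
  have : 0 < N := Nat.pos_of_ne_zero hN
  nlinarith

/-- If `∂A/∂y = ∂B/∂x`, every prime factor of `A` divides `B`, and the leading coefficient of `A`
in `x` is constant, then `A` divides `B`. -/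
theorem dvd_of_dCoeff_eq_derivative {A B : K[X][X]} {k : ℕ} (hA : IsUnit A.leadingCoeff)
    (hAB : dCoeff A = derivative B) (hdvd : A ∣ B ^ k) : A ∣ B := by
  have hA0 : A ≠ 0 := by
    rintro rfl
    simp at hA
  obtain ⟨A', B', c, hrel, rfl, rfl⟩ := UniqueFactorizationMonoid.exists_reduced_factors A hA0 B
  suffices hu : IsUnit A' by
    exact mul_dvd_mul_left c hu.dvd
  by_contra hu
  -- Compare multiplicities at a prime `π` that occurs more often in `A` than in `B`: if `B` has it
  -- `n ≥ 1` times, then `∂B/∂x` has it exactly `n - 1` times, while `∂A/∂y` has it at least `n`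
  -- times.
  obtain ⟨π, hπ, hπA⟩ := WfDvdMonoid.exists_irreducible_factor hu (right_ne_zero_of_mul hA0)
  have hp : Prime π := hπ.prime
  have hπB : ¬ π ∣ B' := fun h => hπ.not_isUnit (hrel hπA h)
  -- Otherwise `π` is free of `x` for degree reasons and divides the leading coefficient of `A`, a
  -- unit.
  have hπx : ¬ π ∣ derivative π := by
    intro h
    have h0 : derivative π = 0 := by
      by_contra hne
      have h1 := natDegree_le_of_dvd h hne
      have h2 : π.natDegree ≠ 0 := by
        intro h3
        rw [eq_C_of_natDegree_eq_zero h3, derivative_C] at hne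
        exact hne rfl
      have := natDegree_derivative_lt h2
      omega
    have h3 := eq_C_of_natDegree_eq_zero (derivative_eq_zero.1 h0)
    rw [h3] at hπA hπ
    have h4 := (C_dvd_iff_dvd_coeff _ _).1 (hπA.mul_left c) (c * A').natDegree
    exact hπ.not_isUnit ((isUnit_of_dvd_unit h4 hA).map C)
  obtain ⟨n, u, rfl, hu'⟩ : ∃ n u, c = π ^ n * u ∧ ¬ π ∣ u := ⟨_, (FiniteMultiplicity.of_not_isUnit hπ.not_isUnit
    (left_ne_zero_of_mul hA0)).exists_eq_pow_mul_and_not_dvd⟩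
  obtain ⟨t, rfl⟩ := hπA
  have hv : ¬ π ∣ u * B' := fun h => (hp.dvd_or_dvd h).elim hu' hπB
  have hn : n ≠ 0 := by
    rintro rfl
    have h1 : π ∣ (π ^ 0 * u * B') ^ k :=
      (((dvd_mul_right π t).mul_left _)).trans hdvd
    have h2 := hp.dvd_of_dvd_pow h1
    rw [pow_zero, one_mul] at h2
    exact hv h2
  obtain ⟨r, rfl⟩ := Nat.exists_eq_succ_of_ne_zero hn
  have hl : dCoeff (π ^ (r + 1) * u * (π * t)) =
      π ^ r * (π * (((r + 2 : ℕ) : K[X][X]) * dCoeff π * (u * t) + π * dCoeff (u * t))) := by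
    have : π ^ (r + 1) * u * (π * t) = π ^ (r + 2) * (u * t) := by ring
    rw [this, dCoeff_mul, Derivation.leibniz_pow]
    simp only [nsmul_eq_mul, smul_eq_mul]
    rw [show r + 2 - 1 = r + 1 from rfl]
    ring
  have hr : derivative (π ^ (r + 1) * u * B') =
      π ^ r * (((r + 1 : ℕ) : K[X][X]) * derivative π * (u * B') + π * derivative (u * B')) := by
    rw [mul_assoc, derivative_mul, derivative_pow]
    rw [show r + 1 - 1 = r from rfl, map_natCast]
    ring
  rw [Nat.succ_eq_add_one, hl, hr] at hAB
  have h5 := mul_left_cancel₀ (pow_ne_zero r hp.ne_zero) hAB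
  have h6 : π ∣ ((r + 1 : ℕ) : K[X][X]) * derivative π * (u * B') :=
    (dvd_add_left (dvd_mul_right π _)).1 (h5 ▸ dvd_mul_right π _)
  rcases hp.dvd_or_dvd h6 with h7 | h7
  · rcases hp.dvd_or_dvd h7 with h8 | h8
    · have h9 : IsUnit ((r + 1 : ℕ) : K[X][X]) := by
        have : ((r + 1 : ℕ) : K[X][X]) = C (C ((r + 1 : ℕ) : K)) := by simp
        rw [this]
        exact (IsUnit.mk0 _ (Nat.cast_ne_zero.2 r.succ_ne_zero)).map (C.comp C)
      exact hπ.not_isUnit (isUnit_of_dvd_unit h8 h9)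
    · exact hπx h8
  · exact hv h7

/-- If `Q` has degree `D` in `x`, the equations bound the degrees of `Z` and `S` by `D + 1` and `2D
+ 1`. The coefficients in these degrees satisfy the system of `derivative_eq_zero_of_ode`. -/
theorem derivative_leadingCoeff_eq_zero {Q Z S : K[X][X]} (hZ : derivative Z = -dCoeff (dCoeff Q))
    (h2 : (dCoeff Q) ^ 2 + derivative Q * Z + derivative S = 0)
    (h3 : derivative Q * dCoeff S = dCoeff Q * derivative S)
    (hQ : derivative Q ≠ 0) : derivative Q.leadingCoeff = 0 := by
  set D := Q.natDegree with hD
  have hD0 : D ≠ 0 := by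
    intro h
    rw [eq_C_of_natDegree_eq_zero h, derivative_C] at hQ
    exact hQ rfl
  obtain ⟨e, he⟩ := Nat.exists_eq_succ_of_ne_zero hD0
  have cZ : ∀ n, ((n + 1 : ℕ) : K[X]) * Z.coeff (n + 1) =
      - derivative (derivative (Q.coeff n)) := by
    intro n
    have := congrArg (fun p => p.coeff n) hZ
    simp only [coeff_derivative, coeff_neg, coeff_dCoeff] at this
    rw [← this]; push_cast; ring
  have hcast : ∀ n : ℕ, ((n + 1 : ℕ) : K[X]) ≠ 0 := fun n => by exact_mod_cast n.succ_ne_zero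
  have dZ : Z.natDegree ≤ D + 1 := by
    rw [natDegree_le_iff_coeff_eq_zero]
    intro N hN
    obtain ⟨n, rfl⟩ : ∃ n, N = n + 1 := ⟨N - 1, by omega⟩
    have := cZ n
    rw [coeff_eq_zero_of_natDegree_lt (show Q.natDegree < n by omega)] at this
    simpa [hcast n, -Nat.cast_add] using this
  have dQy : (dCoeff Q).natDegree ≤ D := natDegree_dCoeff_le Q
  have dQx : (derivative Q).natDegree ≤ e := by
    have := natDegree_derivative_le Q
    omega
  have dSx : (derivative S).natDegree ≤ 2 * D := by
    have : derivative S = -((dCoeff Q) ^ 2 + derivative Q * Z) := by linear_combination h2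
    rw [this, natDegree_neg]
    refine (natDegree_add_le _ _).trans (max_le ?_ ?_)
    · exact natDegree_pow_le.trans (Nat.mul_le_mul_left 2 dQy)
    · exact natDegree_mul_le.trans (by omega)
  have dS : S.natDegree ≤ 2 * D + 1 := by
    rw [natDegree_le_iff_coeff_eq_zero]
    intro N hN
    obtain ⟨n, rfl⟩ : ∃ n, N = n + 1 := ⟨N - 1, by omega⟩
    have := coeff_eq_zero_of_natDegree_lt (show (derivative S).natDegree < n by omega)
    rw [coeff_derivative] at this
    have h4 := hcast n
    push_cast at h4
    exact (mul_eq_zero.1 this).resolve_right h4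
  have cQx : (derivative Q).coeff e = (D : K[X]) * Q.leadingCoeff := by
    rw [coeff_derivative, leadingCoeff, ← hD, he]
    push_cast; ring
  have cSx : (derivative S).coeff (2 * D) = ((2 * D + 1 : ℕ) : K[X]) * S.coeff (2 * D + 1) := by
    rw [coeff_derivative]; push_cast; ring
  refine derivative_eq_zero_of_ode (D := D) (z := Z.coeff (D + 1)) (σ := S.coeff (2 * D + 1))
    ?_ (cZ D) ?_ ?_
  · rw [Ne, leadingCoeff_eq_zero]
    rintro rfl
    simp at hQ
  · have h := congrArg (fun p => p.coeff (2 * D)) h2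
    simp only [coeff_add, coeff_zero] at h
    have ha : ((dCoeff Q) ^ 2).coeff (2 * D) = (derivative Q.leadingCoeff) ^ 2 := by
      rw [sq, two_mul, coeff_mul_add_eq_of_natDegree_le dQy dQy, coeff_dCoeff, sq]; rfl
    have hb : (derivative Q * Z).coeff (2 * D) = D * Q.leadingCoeff * Z.coeff (D + 1) := by
      rw [show 2 * D = e + (D + 1) by omega, coeff_mul_add_eq_of_natDegree_le dQx dZ, cQx]
    rw [ha, hb, cSx] at h
    linear_combination h
  · have h : (derivative Q * dCoeff S).coeff (e + (2 * D + 1)) =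
        (dCoeff Q * derivative S).coeff (e + (2 * D + 1)) := by rw [h3]
    rw [coeff_mul_add_eq_of_natDegree_le dQx ((natDegree_dCoeff_le S).trans dS),
      show e + (2 * D + 1) = D + 2 * D by omega, coeff_mul_add_eq_of_natDegree_le dQy dSx, cQx, cSx,
      coeff_dCoeff, coeff_dCoeff] at h
    change _ = derivative Q.leadingCoeff * _ at h
    linear_combination h

/-- The solution of the system of equations that nilpotency imposes. -/
theorem bivariate_classification {Q Z S : K[X][X]} (hZ : derivative Z = -dCoeff (dCoeff Q))
    (h2 : (dCoeff Q) ^ 2 + derivative Q * Z + derivative S = 0)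
    (h3 : derivative Q * dCoeff S = dCoeff Q * derivative S)
    (hQ : derivative Q ≠ 0) :
    ∃ α β μ ν : K, dCoeff Q = C (C β + C α * X) * derivative Q ∧
      Z = -(C (C β + C α * X) ^ 2 * derivative Q + C (C α) * Q + C (C μ)) ∧
      S = C (C (α / 2)) * Q ^ 2 + C (C μ) * Q + C (C ν) := by
  have hlc := derivative_leadingCoeff_eq_zero hZ h2 h3 hQ
  have hQ0 : Q ≠ 0 := by
    rintro rfl
    simp at hQ
  have hD0 : Q.natDegree ≠ 0 := by
    intro h
    rw [eq_C_of_natDegree_eq_zero h, derivative_C] at hQ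
    exact hQ rfl
  obtain ⟨e, he⟩ := Nat.exists_eq_succ_of_ne_zero hD0
  have cQx : (derivative Q).coeff e = (Q.natDegree : K[X]) * Q.leadingCoeff := by
    rw [coeff_derivative, leadingCoeff, he]
    push_cast; ring
  have hcne : (derivative Q).coeff e ≠ 0 := by
    rw [cQx]
    exact mul_ne_zero (Nat.cast_ne_zero.2 hD0) (leadingCoeff_ne_zero.2 hQ0)
  have dQx : (derivative Q).natDegree = e := by
    refine le_antisymm ?_ (le_natDegree_of_ne_zero hcne)
    have := natDegree_derivative_le Q
    omega
  have hunit : IsUnit (derivative Q).leadingCoeff := by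
    rw [leadingCoeff, dQx]
    rw [cQx] at hcne ⊢
    have h4 := eq_C_of_natDegree_eq_zero (derivative_eq_zero.1 hlc)
    rw [h4, ← map_natCast C, ← map_mul] at hcne ⊢
    exact (IsUnit.mk0 _ (C_ne_zero.1 hcne)).map C
  -- `Q_y` times the second equation, with the third one substituted, is `Q_y³ = -Q_x (Z Q_y +
  -- S_y)`.
  have hcube : derivative Q ∣ (dCoeff Q) ^ 3 :=
    ⟨-(Z * dCoeff Q + dCoeff S), by linear_combination dCoeff Q * h2 + h3⟩
  obtain ⟨W, hW⟩ := dvd_of_dCoeff_eq_derivative hunit (dCoeff_derivative Q) hcube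
  -- The leading coefficient of `Q` is constant, so the degree of `Q_y` in `x` does not exceed that
  -- of `Q_x`.
  have hdW : W.natDegree = 0 := by
    by_contra hne
    have hW0 : W ≠ 0 := by
      rintro rfl
      simp at hne
    have h5 := congrArg natDegree hW
    rw [natDegree_mul hQ hW0, dQx] at h5
    have h6 : (dCoeff Q).natDegree ≤ e := by
      rw [natDegree_le_iff_coeff_eq_zero]
      intro N hN
      rw [coeff_dCoeff]
      rcases eq_or_lt_of_le (show Q.natDegree ≤ N by omega) with h | h
      · rw [← h]; exact hlc
      · rw [coeff_eq_zero_of_natDegree_lt h, derivative_zero]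
    omega
  obtain ⟨w, rfl⟩ : ∃ w, W = C w := ⟨_, eq_C_of_natDegree_eq_zero hdW⟩
  -- `φ` is the factor with `dS = φ dQ`. Closedness of `φ dQ` gives `φ_y = w φ_x`, and equality of
  -- the mixed derivatives of `φ` then gives `Q_x w'' = 0`, so `w` is affine.
  obtain ⟨φ, hφ⟩ : ∃ φ, φ = -Z - C w ^ 2 * derivative Q := ⟨_, rfl⟩
  have hSx : derivative S = φ * derivative Q := by
    rw [hφ]
    linear_combination h2 - (dCoeff Q + derivative Q * C w) * hW
  have hSy : dCoeff S = φ * (derivative Q * C w) := by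
    refine mul_left_cancel₀ hQ ?_
    rw [h3, hSx, hW]; ring
  have hQxy : derivative (dCoeff Q) = derivative (derivative Q) * C w := by
    rw [hW, derivative_mul, derivative_C]; ring
  have hQyy : dCoeff (dCoeff Q) =
      derivative Q * C (derivative w) + derivative (derivative Q) * C w ^ 2 := by
    rw [hW, dCoeff_mul, dCoeff_derivative, hQxy, dCoeff_C]; ring
  have hφx : derivative φ = C (derivative w) * derivative Q := by
    rw [hφ, derivative_sub, derivative_neg, hZ, hQyy, derivative_mul, ← C_pow, derivative_C]
    rw [C_pow]
    ring
  have hφy : dCoeff φ = C w * derivative φ := by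
    have h7 := dCoeff_derivative S
    rw [hSx, hSy, dCoeff_mul, derivative_mul, dCoeff_derivative, hQxy, derivative_mul,
      derivative_C] at h7
    refine mul_left_cancel₀ hQ ?_
    linear_combination h7
  have hw2 : derivative (derivative w) = 0 := by
    have h8 := dCoeff_derivative φ
    rw [hφy, hφx, dCoeff_mul, dCoeff_C, dCoeff_derivative, hQxy] at h8
    simp only [derivative_mul, derivative_C] at h8
    have h9 : derivative Q * C (derivative (derivative w)) = 0 := by linear_combination h8
    exact C_eq_zero.1 ((mul_eq_zero.1 h9).resolve_left hQ)
  obtain ⟨α, hα⟩ : ∃ α, derivative w = C α :=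
    ⟨_, eq_C_of_natDegree_eq_zero (derivative_eq_zero.1 hw2)⟩
  obtain ⟨β, hβ⟩ : ∃ β, w - C α * X = C β :=
    ⟨_, eq_C_of_natDegree_eq_zero (derivative_eq_zero.1 (by simp [hα]))⟩
  obtain rfl : w = C β + C α * X := by rw [← hβ]; ring
  rw [hα] at hφx
  obtain ⟨μ, hμ⟩ := eq_C_C_of_derivative_eq_zero (p := φ - C (C α) * Q)
    (by rw [derivative_sub, hφx, derivative_mul, derivative_C]; ring)
    (by rw [map_sub, hφy, hφx, dCoeff_mul, dCoeff_C, derivative_C, hW, C_0]; ring)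
  have hφ' : φ = C (C α) * Q + C (C μ) := by rw [← hμ]; ring
  have hα2 : C (C α) = 2 * C (C (α / 2)) := by
    rw [two_mul, ← C_add, ← C_add, add_halves]
  obtain ⟨ν, hν⟩ := eq_C_C_of_derivative_eq_zero
    (p := S - C (C (α / 2)) * Q ^ 2 - C (C μ) * Q)
    (by
      simp only [derivative_sub, derivative_mul, derivative_C, sq]
      rw [hSx, hφ', hα2]; ring)
    (by
      simp only [map_sub, dCoeff_mul, dCoeff_C, derivative_C, sq, C_0]
      rw [hSy, hφ', hα2, hW]; ring)
  refine ⟨α, β, μ, ν, by rw [hW]; ring, ?_, by rw [← hν]; ring⟩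
  linear_combination hφ - hφ'

end Bivariate

/-! ### Bases adapted to saturated submodules. -/

section Basis

variable {R : Type*} [CommRing R] [IsDomain R] [IsPrincipalIdealRing R]

/-- A linearly independent family that spans a saturated submodule of `R^m` extends to a basis. -/
theorem exists_gl_extending {m r : ℕ} {v : Fin r → Fin m → R} (hv : LinearIndependent R v)
    (hsat : ∀ (a : R) (x : Fin m → R), a ≠ 0 → a • x ∈ Submodule.span R (Set.range v) →
      x ∈ Submodule.span R (Set.range v)) :
    ∃ (hr : r ≤ m) (g : Matrix.GeneralLinearGroup (Fin m) R),
      (∀ (i : Fin r) (j : Fin m), g.val j (Fin.castLE hr i) = v i j) ∧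
      ∀ x ∈ Submodule.span R (Set.range v), ∀ i : Fin m, r ≤ (i : ℕ) →
        ∑ j, (g⁻¹).val i j * x j = 0 := by
  classical
  set W := Submodule.span R (Set.range v) with hW
  -- Saturation makes the quotient torsion-free, hence free over a PID; a basis of it lifts to
  -- complete `v`.
  have htf : Module.IsTorsionFree R ((Fin m → R) ⧸ W) := by
    rw [Module.isTorsionFree_iff_smul_eq_zero]
    intro a x hx
    obtain ⟨x, rfl⟩ := Submodule.Quotient.mk_surjective W x
    rw [← Submodule.Quotient.mk_smul, Submodule.Quotient.mk_eq_zero] at hx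
    by_cases ha : a = 0
    · exact Or.inl ha
    · exact Or.inr ((Submodule.Quotient.mk_eq_zero W).2 (hsat a x ha hx))
  have hfree : Module.Free R ((Fin m → R) ⧸ W) := Module.free_of_finite_type_torsion_free'
  let bW : Module.Basis (Fin r) R W := Module.Basis.span hv
  let bQ := Module.finBasis R ((Fin m → R) ⧸ W)
  let b₀ := (bW.sumQuot bQ).reindex finSumFinEquiv
  have hcard : r + Module.finrank R ((Fin m → R) ⧸ W) = m := by
    have := Module.finrank_eq_card_basis b₀
    simpa using this.symm
  let b : Module.Basis (Fin m) R (Fin m → R) := b₀.reindex (finCongr hcard)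
  have hr : r ≤ m := by omega
  let e := Pi.basisFun R (Fin m)
  refine ⟨hr, ⟨e.toMatrix b, b.toMatrix e, e.toMatrix_mul_toMatrix_flip b,
    b.toMatrix_mul_toMatrix_flip e⟩, ?_, ?_⟩
  · intro i j
    change e.toMatrix b j (Fin.castLE hr i) = v i j
    rw [Module.Basis.toMatrix_apply, Pi.basisFun_repr]
    have : (finCongr hcard).symm (Fin.castLE hr i) = Fin.castAdd _ i := rfl
    rw [Module.Basis.reindex_apply, this, Module.Basis.reindex_apply,
      finSumFinEquiv_symm_apply_castAdd, Module.Basis.sumQuot_inl]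
    exact congrFun (Module.Basis.coe_span_apply hv i) j
  · intro x hx i hi
    refine (congrFun (e.toMatrix_mulVec_repr b x) i).trans ?_
    obtain ⟨k, hk⟩ : ∃ k, (finCongr hcard).symm i = Fin.natAdd r k :=
      ⟨⟨i - r, by omega⟩, by ext; simp; omega⟩
    rw [Module.Basis.repr_reindex_apply, hk, Module.Basis.repr_reindex_apply,
      finSumFinEquiv_symm_apply_natAdd, Module.Basis.sumQuot_repr_inr_of_mem _ _ _ hx]

theorem exists_gl_adapted {m : ℕ} (N : Submodule R (Fin m → R))
    (hsat : ∀ (a : R) (x : Fin m → R), a ≠ 0 → a • x ∈ N → x ∈ N) :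
    ∃ r ≤ m, ∃ g : Matrix.GeneralLinearGroup (Fin m) R,
      (∀ i : Fin m, (i : ℕ) < r → (fun j => g.val j i) ∈ N) ∧
      ∀ x ∈ N, ∀ i : Fin m, r ≤ (i : ℕ) → ∑ j, (g⁻¹).val i j * x j = 0 := by
  let b := Module.finBasis R N
  have hli : LinearIndependent R (fun i => (b i : Fin m → R)) :=
    b.linearIndependent.map' N.subtype (Submodule.ker_subtype N)
  have hspan : Submodule.span R (Set.range fun i => (b i : Fin m → R)) = N := by
    have : (Set.range fun i => (b i : Fin m → R)) = N.subtype '' Set.range b := by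
      rw [← Set.range_comp]; rfl
    rw [this, ← Submodule.map_span, b.span_eq, Submodule.map_top, Submodule.range_subtype]
  obtain ⟨hr, g, h1, h2⟩ := exists_gl_extending hli (by rwa [hspan])
  rw [hspan] at h2
  refine ⟨_, hr, g, fun i hi => ?_, h2⟩
  convert (b ⟨i, hi⟩).2 using 1
  ext j
  exact h1 ⟨i, hi⟩ j

/-- The vector `f` must come first because it becomes the `x_3`-direction of the third normal form;
the basis of `N` follows it, so coordinate `0` also vanishes on `N`. -/
theorem exists_gl_adapted_cons {F : Type*} [Field F] {m : ℕ} (N : Submodule F (Fin m → F))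
    {f : Fin m → F} (hf : f ∉ N) :
    ∃ r, r + 1 ≤ m ∧ ∃ g : Matrix.GeneralLinearGroup (Fin m) F,
      (∀ i : Fin m, (i : ℕ) = 0 → (fun j => g.val j i) = f) ∧
      (∀ i : Fin m, (i : ℕ) ≠ 0 → (i : ℕ) < r + 1 → (fun j => g.val j i) ∈ N) ∧
      ∀ x ∈ N, ∀ i : Fin m, ((i : ℕ) = 0 ∨ r + 1 ≤ (i : ℕ)) → ∑ j, (g⁻¹).val i j * x j = 0 := by
  let b := Module.finBasis F N
  have hli : LinearIndependent F (fun i => (b i : Fin m → F)) :=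
    b.linearIndependent.map' N.subtype (Submodule.ker_subtype N)
  have hspan : Submodule.span F (Set.range fun i => (b i : Fin m → F)) = N := by
    have : (Set.range fun i => (b i : Fin m → F)) = N.subtype '' Set.range b := by
      rw [← Set.range_comp]; rfl
    rw [this, ← Submodule.map_span, b.span_eq, Submodule.map_top, Submodule.range_subtype]
  have hli' : LinearIndependent F (Fin.cons f fun i => (b i : Fin m → F) : Fin _ → Fin m → F) :=
    hli.finCons (by rwa [hspan])
  obtain ⟨hr, g, h1, h2⟩ := exists_gl_extending hli' (fun a x ha hx => by
    simpa [smul_smul, ha] using Submodule.smul_mem _ a⁻¹ hx)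
  have h3 : ∀ i : Fin m, ∀ _ : (i : ℕ) ≠ 0, ∀ _ : (i : ℕ) < Module.finrank F N + 1,
      ∀ j,
      g.val j i = (b ⟨i - 1, by omega⟩ : Fin m → F) j := by
    intro i h0 hi j
    have h4 := h1 (Fin.succ ⟨i - 1, by omega⟩) j
    rw [Fin.cons_succ] at h4
    rw [← h4]
    refine congrArg (g.val j) (Fin.ext ?_)
    simp
    omega
  have hNspan : ∀ x ∈ N, x ∈ Submodule.span F
      (Set.range (Fin.cons f fun i => (b i : Fin m → F) : Fin _ → Fin m → F)) := by
    intro x hx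
    rw [← hspan] at hx
    refine Submodule.span_mono ?_ hx
    rintro _ ⟨i, rfl⟩
    exact ⟨i.succ, by simp⟩
  refine ⟨_, hr, g, fun i hi => ?_, fun i h0 hi => ?_, fun x hx i hi => ?_⟩
  · ext j
    have h4 := h1 0 j
    rw [Fin.cons_zero] at h4
    rw [← h4]
    refine congrArg (g.val j) (Fin.ext ?_)
    simpa using hi
  · rw [funext (h3 i h0 hi)]
    exact (b _).2
  · rcases hi with hi | hi
    · rw [← hspan] at hx
      induction hx using Submodule.span_induction with
      | mem x hx =>
        obtain ⟨l, rfl⟩ := hx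
        have h5 : ∀ j, (b l : Fin m → F) j = g.val j (Fin.castLE hr l.succ) := by
          intro j; rw [h1]; simp
        simp_rw [h5]
        have h6 := congrFun (congrFun g.inv_mul i) (Fin.castLE hr l.succ)
        rw [Matrix.mul_apply, Matrix.one_apply_ne] at h6
        · exact h6
        · intro h; rw [h] at hi; simp at hi
      | zero => simp
      | add x y _ _ hx hy =>
        simp only [Pi.add_apply, mul_add, Finset.sum_add_distrib, hx, hy, add_zero]
      | smul a x _ hx =>
        simp only [Pi.smul_apply, smul_eq_mul, mul_left_comm _ a, ← Finset.mul_sum, hx, mul_zero]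
    · exact h2 x (hNspan x hx) i hi

end Basis

/-! ### Partial derivatives and the variables that a polynomial involves. -/

section MvPolynomial

open MvPolynomial

theorem pderiv_aeval {R σ τ : Type*} [CommRing R] [Fintype σ] (f : σ → MvPolynomial τ R)
    (i : τ) (p : MvPolynomial σ R) :
    pderiv i (aeval f p) = ∑ j, aeval f (pderiv j p) * pderiv i (f j) := by
  classical
  induction p using MvPolynomial.induction_on with
  | C a => simp
  | add p q hp hq => simp only [map_add, hp, hq, add_mul, Finset.sum_add_distrib]
  | mul_X p j h =>
    simp only [map_mul, aeval_X, pderiv_mul, h, pderiv_X, map_add, add_mul,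
      Finset.sum_add_distrib, Finset.sum_mul, Pi.single_apply]
    congr 1
    · exact Finset.sum_congr rfl fun _ _ => by ring
    · rw [Finset.sum_eq_single j] <;> simp +contextual [eq_comm]

variable {R σ : Type*} [CommRing R] [IsDomain R] [CharZero R]

theorem coeff_eq_zero_of_pderiv_eq_zero {p : MvPolynomial σ R} {i : σ} (h : pderiv i p = 0)
    {s : σ →₀ ℕ} (hs : s i ≠ 0) : coeff s p = 0 := by
  classical
  have h1 := coeff_pderiv (i := i) p (s - Finsupp.single i 1)
  rw [h, coeff_zero, tsub_add_cancel_of_le (by simpa [Nat.one_le_iff_ne_zero] using hs)] at h1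
  exact (mul_eq_zero.1 h1.symm).resolve_right (Nat.cast_add_one_ne_zero _)

theorem mem_adjoin_X_of_pderiv_eq_zero {p : MvPolynomial σ R} {s : Set σ}
    (h : ∀ i ∉ s, pderiv i p = 0) : p ∈ Algebra.adjoin R (X '' s) := by
  rw [← supported_eq_adjoin_X, mem_supported]
  intro i hi
  by_contra his
  obtain ⟨d, hd, hdi⟩ := (mem_vars_iff_mem_support i).1 hi
  exact mem_support_iff.1 hd
    (coeff_eq_zero_of_pderiv_eq_zero (h i his) (Finsupp.mem_support_iff.1 hdi))

theorem eq_C_of_pderiv_eq_zero {p : MvPolynomial σ R} (h : ∀ i, pderiv i p = 0) :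
    ∃ a, p = C a := by
  have := mem_adjoin_X_of_pderiv_eq_zero (s := ∅) (fun i _ => h i)
  rw [Set.image_empty, Algebra.adjoin_empty] at this
  obtain ⟨a, ha⟩ := Algebra.mem_bot.1 this
  exact ⟨a, ha.symm⟩

theorem pderiv_eq_zero_of_mem_adjoin_X {R σ : Type*} [CommRing R]
    {p : MvPolynomial σ R} {s : Set σ} {i : σ} (hi : i ∉ s)
    (h : p ∈ Algebra.adjoin R (X '' s)) : pderiv i p = 0 := by
  induction h using Algebra.adjoin_induction with
  | mem x hx =>
    obtain ⟨j, hj, rfl⟩ := hx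
    exact pderiv_X_of_ne (fun h => hi (h ▸ hj))
  | algebraMap r => exact pderiv_C
  | add x y _ _ hx hy => rw [map_add, hx, hy, add_zero]
  | mul x y _ _ hx hy => rw [pderiv_mul, hx, hy, zero_mul, mul_zero, add_zero]

theorem pderiv_comm {R σ : Type*} [CommSemiring R] (i j : σ) (p : MvPolynomial σ R) :
    pderiv i (pderiv j p) = pderiv j (pderiv i p) := by
  classical
  ext s
  simp only [coeff_pderiv, Finsupp.add_apply, Finsupp.single_apply, add_right_comm s]
  rcases eq_or_ne i j with rfl | h
  · rfl
  · simp [h, h.symm]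
    ring

end MvPolynomial

/-! ### The equations imposed by nilpotency. -/

theorem sum_fin_add_two {M : Type*} [AddCommMonoid M] {m : ℕ} (f : Fin (m + 2) → M) :
    ∑ i, f i = f 0 + (f 1 + ∑ i : Fin m, f i.succ.succ) := by
  rw [Fin.sum_univ_succ, Fin.sum_univ_succ, Fin.succ_zero_eq_one]

/-- The coefficients of the characteristic polynomial of a nilpotent matrix whose rows, except the
first one, vanish outside the first two columns. -/
theorem nilpotent_equations {R : Type*} [CommRing R] [IsDomain R] [CharZero R] {m : ℕ}
    {M : Matrix (Fin (m + 2)) (Fin (m + 2)) R} (hM : IsNilpotent M)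
    (h1 : ∀ j : Fin m, M 1 j.succ.succ = 0) (h2 : ∀ i j : Fin m, M i.succ.succ j.succ.succ = 0) :
    M 0 0 + M 1 1 = 0 ∧
    M 1 1 ^ 2 + M 1 0 * M 0 1 + ∑ i : Fin m, M 0 i.succ.succ * M i.succ.succ 0 = 0 ∧
    M 1 0 * ∑ i : Fin m, M 0 i.succ.succ * M i.succ.succ 1 =
      M 1 1 * ∑ i : Fin m, M 0 i.succ.succ * M i.succ.succ 0 := by
  have t1 : M.trace = 0 := (Matrix.isNilpotent_trace_of_isNilpotent hM).eq_zero
  have t2 : (M * M).trace = 0 := (Matrix.isNilpotent_trace_of_isNilpotent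
    ((Commute.refl M).isNilpotent_mul_right hM)).eq_zero
  have t3 : (M * M * M).trace = 0 := (Matrix.isNilpotent_trace_of_isNilpotent
    (((Commute.refl M).mul_left (Commute.refl M)).isNilpotent_mul_left hM)).eq_zero
  set σ := ∑ i : Fin m, M 0 i.succ.succ * M i.succ.succ 0 with hσ
  set τ := ∑ i : Fin m, M 0 i.succ.succ * M i.succ.succ 1 with hτ
  have e1 : M 0 0 + M 1 1 = 0 := by
    have : M.trace = M 0 0 + M 1 1 := by
      simp [Matrix.trace, sum_fin_add_two, h2]
    rw [← this, t1]
  have q00 : (M * M) 0 0 = M 0 0 ^ 2 + M 0 1 * M 1 0 + σ := by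
    rw [Matrix.mul_apply, sum_fin_add_two, ← hσ]; ring
  have q01 : (M * M) 0 1 = M 0 0 * M 0 1 + M 0 1 * M 1 1 + τ := by
    rw [Matrix.mul_apply, sum_fin_add_two, ← hτ]; ring
  have q0i (i : Fin m) : (M * M) 0 i.succ.succ = M 0 0 * M 0 i.succ.succ := by
    simp [Matrix.mul_apply, sum_fin_add_two, h1, h2]
  have q10 : (M * M) 1 0 = M 1 0 * M 0 0 + M 1 1 * M 1 0 := by
    simp [Matrix.mul_apply, sum_fin_add_two, h1]
  have q11 : (M * M) 1 1 = M 1 0 * M 0 1 + M 1 1 * M 1 1 := by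
    simp [Matrix.mul_apply, sum_fin_add_two, h1]
  have q1i (i : Fin m) : (M * M) 1 i.succ.succ = M 1 0 * M 0 i.succ.succ := by
    simp [Matrix.mul_apply, sum_fin_add_two, h1]
  have qi0 (i : Fin m) : (M * M) i.succ.succ 0 =
      M i.succ.succ 0 * M 0 0 + M i.succ.succ 1 * M 1 0 := by
    simp [Matrix.mul_apply, sum_fin_add_two, h2]
  have qij (i j : Fin m) : (M * M) i.succ.succ j.succ.succ =
      M i.succ.succ 0 * M 0 j.succ.succ := by
    simp [Matrix.mul_apply, sum_fin_add_two, h1, h2]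
  have e2' : (M * M).trace = M 0 0 ^ 2 + 2 * (M 0 1 * M 1 0) + M 1 1 ^ 2 + 2 * σ := by
    simp only [Matrix.trace, Matrix.diag, sum_fin_add_two, q00, q11, qij]
    have : ∑ i : Fin m, M i.succ.succ 0 * M 0 i.succ.succ = σ :=
      Finset.sum_congr rfl fun _ _ => mul_comm _ _
    rw [this]; ring
  have e2 : M 1 1 ^ 2 + M 1 0 * M 0 1 + σ = 0 := by
    refine mul_left_cancel₀ (two_ne_zero (α := R)) ?_
    linear_combination t2 - e2' - (M 0 0 - M 1 1) * e1
  refine ⟨e1, e2, ?_⟩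
  have s0 : ∑ i : Fin m, (M * M) 0 i.succ.succ * M i.succ.succ 0 = M 0 0 * σ := by
    simp only [q0i, hσ, Finset.mul_sum, mul_assoc]
  have s1 : ∑ i : Fin m, (M * M) 1 i.succ.succ * M i.succ.succ 1 = M 1 0 * τ := by
    simp only [q1i, hτ, Finset.mul_sum, mul_assoc]
  have s2 : ∑ i : Fin m, (M * M) i.succ.succ 0 * M 0 i.succ.succ = M 0 0 * σ + M 1 0 * τ := by
    rw [hσ, hτ, Finset.mul_sum, Finset.mul_sum, ← Finset.sum_add_distrib]
    refine Finset.sum_congr rfl fun i _ => ?_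
    rw [qi0]; ring
  have e3' : (M * M * M).trace = (M * M) 0 0 * M 0 0 + (M * M) 0 1 * M 1 0 + M 0 0 * σ +
      ((M * M) 1 0 * M 0 1 + (M * M) 1 1 * M 1 1 + M 1 0 * τ) + (M 0 0 * σ + M 1 0 * τ) := by
    rw [← s2]
    simp only [Matrix.trace, Matrix.diag, Matrix.mul_apply (M := M * M), sum_fin_add_two]
    rw [s0, s1]
    have : ∀ i : Fin m, ((M * M) i.succ.succ 0 * M 0 i.succ.succ +
      ((M * M) i.succ.succ 1 * M 1 i.succ.succ +
        ∑ j : Fin m, (M * M) i.succ.succ j.succ.succ * M j.succ.succ i.succ.succ)) =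
        (M * M) i.succ.succ 0 * M 0 i.succ.succ := by
      intro i
      simp [h1, h2]
    simp only [this]
    ring
  rw [t3, q00, q01, q10, q11] at e3'
  have hp : M 0 0 = -M 1 1 := by linear_combination e1
  rw [hp] at e3'
  -- With `M 0 0 = -M 1 1`, the trace of the cube collapses to `3 (M 1 0 · τ - M 1 1 · σ)`.
  refine mul_left_cancel₀ (show (3 : R) ≠ 0 by exact_mod_cast (by norm_num : (3 : ℕ) ≠ 0)) ?_
  linear_combination -e3'

/-! ### Polynomials in `x_1, x_2` and the ring `K[x_2][x_1]`. -/

section Form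

open MvPolynomial

variable {K : Type*} [Field K] {m : ℕ}

/-- The polynomials in `x_1` and `x_2`, as the common kernel of the other partial derivatives. -/
def IsBivariate (p : MvPolynomial (Fin (m + 2)) K) : Prop :=
  ∀ i : Fin m, pderiv i.succ.succ p = 0

/-- The restriction to the plane of `x_1` and `x_2`, with values in `K[x_2][x_1]`. -/
noncomputable def toBivariate : MvPolynomial (Fin (m + 2)) K →ₐ[K] Polynomial (Polynomial K) :=
  aeval (Fin.cons Polynomial.X (Fin.cons (Polynomial.C Polynomial.X) fun _ => 0))

/-- The embedding of `K[x_2][x_1]` in `K[x_1, …, x_n]`. -/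
noncomputable def ofBivariate : Polynomial (Polynomial K) →ₐ[K] MvPolynomial (Fin (m + 2)) K :=
  Polynomial.aevalAeval (X 1) (X 0)

@[simp] theorem toBivariate_X_zero :
    toBivariate (X 0 : MvPolynomial (Fin (m + 2)) K) = Polynomial.X := by
  simp [toBivariate]

@[simp] theorem toBivariate_X_one :
    toBivariate (X 1 : MvPolynomial (Fin (m + 2)) K) = Polynomial.C Polynomial.X := by
  rw [toBivariate, aeval_X]; rfl

@[simp] theorem toBivariate_X_succ_succ (i : Fin m) :
    toBivariate (X i.succ.succ : MvPolynomial (Fin (m + 2)) K) = 0 := by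
  simp [toBivariate]

@[simp] theorem toBivariate_C (a : K) :
    toBivariate (C a : MvPolynomial (Fin (m + 2)) K) = Polynomial.C (Polynomial.C a) := by
  rw [toBivariate, aeval_C]; rfl

theorem ofBivariate_C (p : Polynomial K) :
    (ofBivariate (Polynomial.C p) : MvPolynomial (Fin (m + 2)) K) = inX2 p := by
  simp [ofBivariate, inX2, Polynomial.aeval_def, Polynomial.eval₂_eq_eval_map]

@[simp] theorem ofBivariate_X :
    (ofBivariate Polynomial.X : MvPolynomial (Fin (m + 2)) K) = X 0 := by
  simp [ofBivariate]

theorem forall_fin_add_two {P : Fin (m + 2) → Prop} (h0 : P 0) (h1 : P 1)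
    (h : ∀ i : Fin m, P i.succ.succ) : ∀ i, P i :=
  Fin.cases h0 (Fin.cases h1 h)

theorem toBivariate_pderiv_zero (p : MvPolynomial (Fin (m + 2)) K) :
    toBivariate (pderiv 0 p) = Polynomial.derivative (toBivariate p) := by
  induction p using MvPolynomial.induction_on with
  | C a => simp
  | add p q hp hq => simp only [map_add, hp, hq]
  | mul_X p j h =>
    simp only [map_mul, pderiv_mul, h, map_add, Polynomial.derivative_mul]
    congr 2
    induction j using forall_fin_add_two with
    | h0 => simp
    | h1 => rw [pderiv_X_of_ne (by simp)]; simp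
    | h i => rw [pderiv_X_of_ne (Fin.succ_ne_zero _)]; simp

theorem toBivariate_pderiv_one (p : MvPolynomial (Fin (m + 2)) K) :
    toBivariate (pderiv 1 p) = dCoeff (toBivariate p) := by
  induction p using MvPolynomial.induction_on with
  | C a => simp
  | add p q hp hq => simp only [map_add, hp, hq]
  | mul_X p j h =>
    simp only [map_mul, pderiv_mul, h, map_add, dCoeff_mul]
    congr 2
    induction j using forall_fin_add_two with
    | h0 => rw [pderiv_X_of_ne (by simp)]; simp
    | h1 => simp
    | h i =>
      rw [pderiv_X_of_ne]
      · simp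
      · exact fun h => Fin.succ_ne_zero i (Fin.succ_injective _ h)

theorem adjoin_pair_eq : Algebra.adjoin K ({X 0, X 1} : Set (MvPolynomial (Fin (m + 2)) K)) =
    Algebra.adjoin K (X '' {0, 1}) := by
  rw [Set.image_pair]

theorem isBivariate_of_mem_adjoin {p : MvPolynomial (Fin (m + 2)) K}
    (h : p ∈ Algebra.adjoin K ({X 0, X 1} : Set (MvPolynomial (Fin (m + 2)) K))) :
    IsBivariate p := by
  intro i
  rw [adjoin_pair_eq] at h
  refine pderiv_eq_zero_of_mem_adjoin_X ?_ h
  rintro (h | h)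
  · exact Fin.succ_ne_zero _ h
  · exact Fin.succ_ne_zero i (Fin.succ_injective _ h)

theorem ofBivariate_toBivariate_of_mem {p : MvPolynomial (Fin (m + 2)) K}
    (h : p ∈ Algebra.adjoin K ({X 0, X 1} : Set (MvPolynomial (Fin (m + 2)) K))) :
    ofBivariate (toBivariate p) = p := by
  induction h using Algebra.adjoin_induction with
  | mem x hx =>
    rcases hx with rfl | rfl
    · simp
    · rw [toBivariate_X_one, ofBivariate_C, inX2, Polynomial.aeval_X]
  | algebraMap r => rw [AlgHom.commutes, AlgHom.commutes]
  | add x y _ _ hx hy => rw [map_add, map_add, hx, hy]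
  | mul x y _ _ hx hy => rw [map_mul, map_mul, hx, hy]

theorem ofBivariate_mem (q : Polynomial (Polynomial K)) : ofBivariate q ∈
    Algebra.adjoin K ({X 0, X 1} : Set (MvPolynomial (Fin (m + 2)) K)) := by
  have h0 : X 0 ∈ Algebra.adjoin K ({X 0, X 1} : Set (MvPolynomial (Fin (m + 2)) K)) :=
    Algebra.subset_adjoin (by simp)
  have h1 : X 1 ∈ Algebra.adjoin K ({X 0, X 1} : Set (MvPolynomial (Fin (m + 2)) K)) :=
    Algebra.subset_adjoin (by simp)
  induction q using Polynomial.induction_on' with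
  | add p q hp hq => rw [map_add]; exact add_mem hp hq
  | monomial n a =>
    rw [← Polynomial.C_mul_X_pow_eq_monomial, map_mul, map_pow, ofBivariate_X, ofBivariate_C, inX2]
    refine mul_mem ?_ (pow_mem h0 n)
    exact Algebra.adjoin_mono (by simp) (Polynomial.aeval_mem_adjoin_singleton K (X 1))

variable [CharZero K]

theorem mem_adjoin_of_isBivariate {p : MvPolynomial (Fin (m + 2)) K} (h : IsBivariate p) :
    p ∈ Algebra.adjoin K ({X 0, X 1} : Set (MvPolynomial (Fin (m + 2)) K)) := by
  rw [adjoin_pair_eq]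
  refine mem_adjoin_X_of_pderiv_eq_zero fun i hi => ?_
  induction i using forall_fin_add_two with
  | h0 => simp at hi
  | h1 => simp at hi
  | h i => exact h i

theorem IsBivariate.eq_of_toBivariate_eq {p q : MvPolynomial (Fin (m + 2)) K}
    (hp : IsBivariate p) (hq : IsBivariate q) (h : toBivariate p = toBivariate q) : p = q := by
  rw [← ofBivariate_toBivariate_of_mem (mem_adjoin_of_isBivariate hp), h,
    ofBivariate_toBivariate_of_mem (mem_adjoin_of_isBivariate hq)]

end Form

/-! ### The first normal form. -/

section NormalFormI

open MvPolynomial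

variable {K : Type*} [Field K] {m : ℕ}

theorem inX2_mem (p : Polynomial K) :
    (inX2 p : MvPolynomial (Fin (m + 2)) K) ∈ Algebra.adjoin K (X '' {1}) := by
  rw [Set.image_singleton]
  exact Polynomial.aeval_mem_adjoin_singleton K (X 1)

theorem pderiv_inX2 {i : Fin (m + 2)} (hi : i ≠ 1) (p : Polynomial K) :
    pderiv i (inX2 p) = 0 :=
  pderiv_eq_zero_of_mem_adjoin_X hi (inX2_mem p)

theorem inX2_mul (p q : Polynomial K) :
    (inX2 (p * q) : MvPolynomial (Fin (m + 2)) K) = inX2 p * inX2 q := map_mul _ _ _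

theorem inX2_sum {ι : Type*} (s : Finset ι) (f : ι → Polynomial K) :
    (inX2 (∑ i ∈ s, f i) : MvPolynomial (Fin (m + 2)) K) = ∑ i ∈ s, inX2 (f i) := map_sum _ _ _

theorem map_inX2 {m' : ℕ} (f : MvPolynomial (Fin (m + 2)) K →ₐ[K] MvPolynomial (Fin (m' + 2)) K)
    (hf : f (X 1) = X 1) (p : Polynomial K) : f (inX2 p) = inX2 p := by
  rw [inX2, ← Polynomial.aeval_algHom_apply, hf, inX2]

theorem inX2_ne_zero {p : Polynomial K} (hp : p ≠ 0) :
    (inX2 p : MvPolynomial (Fin (m + 2)) K) ≠ 0 := by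
  intro h
  have h1 : toBivariate (inX2 p : MvPolynomial (Fin (m + 2)) K) = Polynomial.C p := by
    rw [inX2, ← Polynomial.aeval_algHom_apply, toBivariate_X_one]
    have := Polynomial.aeval_algHom_apply (Algebra.ofId (Polynomial K)
      (Polynomial (Polynomial K)) |>.restrictScalars K) Polynomial.X p
    simpa using this
  rw [h, map_zero] at h1
  exact hp (Polynomial.C_eq_zero.1 h1.symm)

theorem pderiv_succ_succ_X_succ_succ (i j : Fin m) :
    pderiv i.succ.succ (X j.succ.succ : MvPolynomial (Fin (m + 2)) K) = if i = j then 1 else 0 := by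
  split_ifs with h
  · rw [h, pderiv_X_self]
  · exact pderiv_X_of_ne fun h' => h (Fin.succ_injective _ (Fin.succ_injective _ h')).symm

theorem succ_succ_ne_one (i : Fin m) : i.succ.succ ≠ (1 : Fin (m + 2)) :=
  fun h => Fin.succ_ne_zero i (Fin.succ_injective _ h)

/-- The substitution of linear forms over `K[x_2]` for `x_3, …, x_n`. -/
noncomputable def rowSubst (A : Matrix (Fin m) (Fin m) (Polynomial K)) :
    MvPolynomial (Fin (m + 2)) K →ₐ[K] MvPolynomial (Fin (m + 2)) K :=
  aeval (Fin.cons (X 0) (Fin.cons (X 1) fun j => rowForm A j))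

theorem rowSubst_X_zero (A : Matrix (Fin m) (Fin m) (Polynomial K)) :
    rowSubst A (X 0) = X 0 := by
  rw [rowSubst, aeval_X]; rfl

theorem rowSubst_X_one (A : Matrix (Fin m) (Fin m) (Polynomial K)) :
    rowSubst A (X 1) = X 1 := by
  rw [rowSubst, aeval_X]; rfl

theorem rowSubst_X_succ_succ (A : Matrix (Fin m) (Fin m) (Polynomial K)) (i : Fin m) :
    rowSubst A (X i.succ.succ) = rowForm A i := by
  rw [rowSubst, aeval_X]; rfl

theorem rowSubst_rowSubst {A B : Matrix (Fin m) (Fin m) (Polynomial K)} (h : A * B = 1)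
    (p : MvPolynomial (Fin (m + 2)) K) : rowSubst B (rowSubst A p) = p := by
  suffices hh : (rowSubst B).comp (rowSubst A) = AlgHom.id K _ from DFunLike.congr_fun hh p
  refine algHom_ext fun i => ?_
  change rowSubst B (rowSubst A (X i)) = X i
  induction i using forall_fin_add_two with
  | h0 => rw [rowSubst_X_zero, rowSubst_X_zero]
  | h1 => rw [rowSubst_X_one, rowSubst_X_one]
  | h i =>
    rw [rowSubst_X_succ_succ, rowForm, map_sum]
    simp only [map_mul, rowSubst_X_succ_succ, map_inX2 _ (rowSubst_X_one B), rowForm,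
      Finset.mul_sum]
    rw [Finset.sum_comm]
    have : ∀ l, ∑ j, inX2 (A i j) * (inX2 (B j l) * X l.succ.succ) =
        (inX2 ((A * B) i l) * X l.succ.succ : MvPolynomial (Fin (m + 2)) K) := by
      intro l
      simp only [Matrix.mul_apply, inX2_sum, inX2_mul, Finset.sum_mul, mul_assoc]
    simp only [this, h, Matrix.one_apply]
    rw [Finset.sum_eq_single i]
    · simp [inX2]
    · intro j _ hj
      simp [inX2, hj.symm]
    · simp

theorem pderiv_rowForm (A : Matrix (Fin m) (Fin m) (Polynomial K)) (i j : Fin m) :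
    pderiv i.succ.succ (rowForm A j) = inX2 (A j i) := by
  rw [rowForm, map_sum]
  simp only [pderiv_mul, pderiv_inX2 (succ_succ_ne_one i), pderiv_succ_succ_X_succ_succ]
  simp

theorem pderiv_zero_rowForm (A : Matrix (Fin m) (Fin m) (Polynomial K)) (j : Fin m) :
    pderiv 0 (rowForm A j) = 0 := by
  rw [rowForm, map_sum]
  refine Finset.sum_eq_zero fun l _ => ?_
  rw [pderiv_mul, pderiv_inX2 (by simp), pderiv_X_of_ne (Fin.succ_ne_zero _)]
  simp

theorem pderiv_zero_rowSubst (A : Matrix (Fin m) (Fin m) (Polynomial K))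
    (p : MvPolynomial (Fin (m + 2)) K) :
    pderiv 0 (rowSubst A p) = rowSubst A (pderiv 0 p) := by
  rw [rowSubst, pderiv_aeval, ← rowSubst, sum_fin_add_two]
  simp [pderiv_zero_rowForm]

theorem pderiv_succ_succ_rowSubst (A : Matrix (Fin m) (Fin m) (Polynomial K))
    (p : MvPolynomial (Fin (m + 2)) K) (i : Fin m) :
    pderiv i.succ.succ (rowSubst A p) =
      rowSubst A (∑ j, inX2 (A j i) * pderiv j.succ.succ p) := by
  rw [rowSubst, pderiv_aeval, ← rowSubst, sum_fin_add_two, map_sum]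
  have h0 : pderiv i.succ.succ (X 0 : MvPolynomial (Fin (m + 2)) K) = 0 :=
    pderiv_X_of_ne (Fin.succ_ne_zero _).symm
  have h1 : pderiv i.succ.succ (X 1 : MvPolynomial (Fin (m + 2)) K) = 0 :=
    pderiv_X_of_ne (succ_succ_ne_one i).symm
  have e : (1 : Fin (m + 2)) = Fin.succ 0 := rfl
  simp only [Fin.cons_zero, Fin.cons_succ, h0, mul_zero, zero_add]
  rw [e, Fin.cons_succ, Fin.cons_zero, ← e, h1, mul_zero, zero_add]
  refine Finset.sum_congr rfl fun j _ => ?_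
  rw [pderiv_rowForm, map_mul, map_inX2 _ (rowSubst_X_one A), mul_comm]

theorem pderiv_zero_ofBivariate (q : Polynomial (Polynomial K)) :
    pderiv 0 (ofBivariate q : MvPolynomial (Fin (m + 2)) K) =
      ofBivariate (Polynomial.derivative q) := by
  induction q using Polynomial.induction_on' with
  | add p q hp hq => simp only [map_add, hp, hq]
  | monomial n a =>
    rw [← Polynomial.C_mul_X_pow_eq_monomial, map_mul, map_pow, ofBivariate_X, ofBivariate_C,
      pderiv_mul, pderiv_inX2 (by simp), Polynomial.derivative_C_mul, map_mul, ofBivariate_C,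
      pderiv_pow, pderiv_X_self, Polynomial.derivative_X_pow]
    simp

theorem atX1Zero_eq_self [CharZero K] {p : MvPolynomial (Fin (m + 2)) K} (h : pderiv 0 p = 0) :
    atX1Zero p = p := by
  have hp : p ∈ Algebra.adjoin K (X '' {0}ᶜ) :=
    mem_adjoin_X_of_pderiv_eq_zero fun i hi => by
      obtain rfl : i = 0 := by simpa using hi
      exact h
  have hle : Algebra.adjoin K (X '' {0}ᶜ) ≤ AlgHom.equalizer
      (aeval (fun i => if i = 0 then 0 else X i)) (AlgHom.id K (MvPolynomial (Fin (m + 2)) K)) := by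
    rw [Algebra.adjoin_le_iff]
    rintro _ ⟨i, hi, rfl⟩
    change aeval _ (X i) = X i
    rw [aeval_X]
    exact if_neg hi
  exact hle hp

theorem atX1Zero_ofBivariate (q : Polynomial (Polynomial K)) :
    atX1Zero (ofBivariate q : MvPolynomial (Fin (m + 2)) K) = inX2 (q.coeff 0) := by
  unfold atX1Zero
  induction q using Polynomial.induction_on' with
  | add p q hp hq => rw [map_add, map_add, hp, hq, Polynomial.coeff_add, inX2, inX2, inX2, map_add]
  | monomial n a =>
    rw [← Polynomial.C_mul_X_pow_eq_monomial, map_mul, map_pow, ofBivariate_X, ofBivariate_C,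
      map_mul, map_pow, map_inX2 _ (by rw [aeval_X, if_neg (by simp)]), aeval_X, if_pos rfl]
    rcases Nat.eq_zero_or_pos n with rfl | hn
    · simp
    · rw [zero_pow hn.ne', Polynomial.C_mul_X_pow_eq_monomial, Polynomial.coeff_monomial,
        if_neg hn.ne', mul_zero, inX2, map_zero]

/-- Comparison of the coefficients of the powers of `x_1`. -/
theorem sum_inX2_coeff_eq_zero [CharZero K] {ι : Type*} (s : Finset ι)
    {G : ι → MvPolynomial (Fin (m + 2)) K} (hG : ∀ i, pderiv 0 (G i) = 0) (d : ℕ) :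
    ∀ {q : ι → Polynomial (Polynomial K)}, ∑ i ∈ s, ofBivariate (q i) * G i = 0 →
      ∑ i ∈ s, inX2 ((q i).coeff d) * G i = 0 := by
  induction d with
  | zero =>
    intro q h
    have h1 := congrArg atX1Zero h
    unfold atX1Zero at h1
    rw [map_sum, map_zero] at h1
    rw [← h1]
    refine Finset.sum_congr rfl fun i _ => ?_
    rw [map_mul, ← atX1Zero, ← atX1Zero, atX1Zero_ofBivariate, atX1Zero_eq_self (hG i)]
  | succ d ih =>
    intro q h
    -- Differentiation in `x_1` leaves the `G i` alone and moves the coefficient of index `d + 1` to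
    -- index `d`, up to the factor `d + 1`.
    have h1 := congrArg (pderiv 0) h
    rw [map_sum, map_zero] at h1
    simp only [pderiv_mul, hG, mul_zero, add_zero, pderiv_zero_ofBivariate] at h1
    have h2 := ih h1
    simp only [Polynomial.coeff_derivative, inX2_mul] at h2
    have h3 : (inX2 ((d : Polynomial K) + 1) : MvPolynomial (Fin (m + 2)) K) *
        ∑ i ∈ s, inX2 ((q i).coeff (d + 1)) * G i = 0 := by
      rw [← h2, Finset.mul_sum]
      exact Finset.sum_congr rfl fun i _ => by ring
    exact (mul_eq_zero.1 h3).resolve_left (inX2_ne_zero (Nat.cast_add_one_ne_zero d))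

/-- `N` is the module of `K[x_2]`-linear relations between the `∂_i H_1`, `i ≥ 3`. In coordinates
adapted to it, `H_1` does not involve the variables that belong to `N`, while `(H_3, …, H_n)`
depends on `x_1` only through them. -/
theorem normalFormI_of_eq_zero [CharZero K] {H : Map (m + 2) K} (hform : HasForm H) (h1 : H 1 = 0)
    (h0 : pderiv 0 (H 0) = 0)
    (hsum : ∑ i : Fin m, pderiv i.succ.succ (H 0) * pderiv 0 (H i.succ.succ) = 0) :
    NormalFormI H := by
  let N : Submodule (Polynomial K) (Fin m → Polynomial K) :=
    { carrier := {v | ∑ i, inX2 (v i) * pderiv i.succ.succ (H 0) = 0}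
      add_mem' := by
        intro v w hv hw
        simp only [Set.mem_ofPred_eq] at hv hw ⊢
        simp only [Pi.add_apply, inX2, map_add, add_mul, Finset.sum_add_distrib] at hv hw ⊢
        rw [hv, hw, add_zero]
      zero_mem' := by simp [inX2]
      smul_mem' := by
        intro a v hv
        simp only [Set.mem_ofPred_eq] at hv ⊢
        simp only [Pi.smul_apply, smul_eq_mul, inX2_mul, mul_assoc, ← Finset.mul_sum, hv,
          mul_zero] }
  have hN : ∀ v, v ∈ N ↔ ∑ i, inX2 (v i) * pderiv i.succ.succ (H 0) = 0 := fun v => Iff.rfl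
  obtain ⟨r, hr, g, hg1, hg2⟩ := exists_gl_adapted N (fun a x ha hx => by
    rw [hN] at hx ⊢
    simp only [Pi.smul_apply, smul_eq_mul, inX2_mul, mul_assoc, ← Finset.mul_sum] at hx
    exact (mul_eq_zero.1 hx).resolve_left (inX2_ne_zero ha))
  -- The first `r = k - 2` columns of `g = A⁻¹` lie in `N`.
  refine ⟨h1, r + 2, by omega, by omega, g⁻¹, ?_, ?_⟩
  · have hmem : rowSubst g.val (H 0) ∈ Algebra.adjoin K
        (X '' (insert 1 {l | ∃ i : Fin m, r ≤ (i : ℕ) ∧ l = i.succ.succ})) := by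
      refine mem_adjoin_X_of_pderiv_eq_zero fun l hl => ?_
      induction l using forall_fin_add_two with
      | h0 => rw [pderiv_zero_rowSubst, h0, map_zero]
      | h1 => simp at hl
      | h i =>
        have hi : (i : ℕ) < r := by
          by_contra hi
          exact hl (Or.inr ⟨i, by omega, rfl⟩)
        rw [pderiv_succ_succ_rowSubst, (hN _).1 (hg1 i hi), map_zero]
    have h2 := Subalgebra.mem_map.2 ⟨_, hmem, rowSubst_rowSubst (B := (g⁻¹).val) g.mul_inv (H 0)⟩
    rw [AlgHom.map_adjoin] at h2
    refine Algebra.adjoin_mono ?_ h2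
    rintro _ ⟨_, ⟨l, hl, rfl⟩, rfl⟩
    rcases hl with rfl | ⟨i, hi, rfl⟩
    · exact Or.inl (rowSubst_X_one _)
    · exact Or.inr ⟨i, by omega, rowSubst_X_succ_succ _ i⟩
  · set q : Fin m → Polynomial (Polynomial K) := fun i => toBivariate (H i.succ.succ) with hq
    have hHq : ∀ i, H i.succ.succ = ofBivariate (q i) := fun i =>
      (ofBivariate_toBivariate_of_mem (hform _ (Fin.succ_ne_zero _))).symm
    have hcoeff : ∀ d, (fun i => (q i).coeff (d + 1)) ∈ N := by
      intro d
      have h3 := sum_inX2_coeff_eq_zero Finset.univ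
        (G := fun i : Fin m => pderiv i.succ.succ (H 0))
        (fun i => by rw [pderiv_comm, h0, map_zero]) d
        (q := fun i => Polynomial.derivative (q i)) (by
          rw [← hsum]
          refine Finset.sum_congr rfl fun i _ => ?_
          rw [hHq i, pderiv_zero_ofBivariate, mul_comm])
      have h4 : ((d : Polynomial K) + 1) • (fun i => (q i).coeff (d + 1)) ∈ N := by
        rw [hN, ← h3]
        refine Finset.sum_congr rfl fun i _ => ?_
        rw [Polynomial.coeff_derivative, Pi.smul_apply, smul_eq_mul, mul_comm (q i |>.coeff _)]
      rw [hN] at h4 ⊢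
      simp only [Pi.smul_apply, smul_eq_mul, inX2_mul, mul_assoc, ← Finset.mul_sum] at h4
      exact (mul_eq_zero.1 h4).resolve_left (inX2_ne_zero (Nat.cast_add_one_ne_zero d))
    -- The coordinates of `H_i - H_i(0, x_2)` with respect to the columns of `g`; those of index at
    -- least `r` vanish since all coefficient vectors lie in `N`.
    set c : Fin m → Polynomial (Polynomial K) := fun j =>
      ∑ i, Polynomial.C ((g⁻¹).val j i) * (q i - Polynomial.C ((q i).coeff 0)) with hc
    have hc0 : ∀ j : Fin m, r ≤ (j : ℕ) → c j = 0 := by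
      intro j hj
      ext1 d
      rw [hc]
      simp only [Polynomial.finsetSum_coeff, Polynomial.coeff_C_mul, Polynomial.coeff_sub,
        Polynomial.coeff_C, Polynomial.coeff_zero]
      cases d with
      | zero => simp
      | succ d =>
        simp only [Nat.succ_ne_zero, if_false, sub_zero]
        exact hg2 _ (hcoeff d) j hj
    refine ⟨fun j => ofBivariate (c j), fun j => ofBivariate_mem _, fun i => ?_⟩
    rw [inv_inv, hHq i, atX1Zero_ofBivariate, ← ofBivariate_C, ← map_sub]
    simp only [← ofBivariate_C, ← map_mul, ← map_sum]
    congr 1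
    have h5 : ∑ j ∈ Finset.univ.filter (fun j : Fin m => (j : ℕ) + 2 < r + 2),
        c j * Polynomial.C (g.val i j) = ∑ j, c j * Polynomial.C (g.val i j) := by
      refine Finset.sum_subset (Finset.filter_subset _ _) fun j _ hj => ?_
      rw [hc0 j (by simpa using hj), zero_mul]
    rw [h5, hc]
    simp only [Finset.sum_mul]
    rw [Finset.sum_comm]
    have h6 : ∀ l, ∑ j, Polynomial.C ((g⁻¹).val j l) * (q l - Polynomial.C ((q l).coeff 0)) *
        Polynomial.C (g.val i j) = Polynomial.C ((1 : Matrix (Fin m) (Fin m) (Polynomial K)) i l) *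
          (q l - Polynomial.C ((q l).coeff 0)) := by
      intro l
      rw [← g.mul_inv, Matrix.mul_apply, map_sum, Finset.sum_mul]
      refine Finset.sum_congr rfl fun j _ => ?_
      rw [map_mul]; ring
    simp only [h6, Matrix.one_apply]
    rw [Finset.sum_eq_single i]
    · simp
    · intro j _ hj
      simp [hj.symm]
    · simp

end NormalFormI

/-! ### From polynomial vector fields to constant directions. -/

section Directions

open MvPolynomial

variable {K : Type*} [Field K] {m : ℕ}

namespace IsBivariate

variable {p q : MvPolynomial (Fin (m + 2)) K}

theorem add (hp : IsBivariate p) (hq : IsBivariate q) : IsBivariate (p + q) :=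
  fun i => by rw [map_add, hp i, hq i, add_zero]

theorem neg (hp : IsBivariate p) : IsBivariate (-p) :=
  fun i => by rw [map_neg, hp i, neg_zero]

theorem sub (hp : IsBivariate p) (hq : IsBivariate q) : IsBivariate (p - q) :=
  fun i => by rw [map_sub, hp i, hq i, sub_zero]

theorem mul (hp : IsBivariate p) (hq : IsBivariate q) : IsBivariate (p * q) :=
  fun i => by rw [pderiv_mul, hp i, hq i, zero_mul, mul_zero, add_zero]

theorem pow (hp : IsBivariate p) (n : ℕ) : IsBivariate (p ^ n) :=
  fun i => by rw [pderiv_pow, hp i, mul_zero]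

theorem const (a : K) : IsBivariate (C a : MvPolynomial (Fin (m + 2)) K) := fun _ => pderiv_C

theorem zero : IsBivariate (0 : MvPolynomial (Fin (m + 2)) K) := fun _ => map_zero _

theorem X_one : IsBivariate (X 1 : MvPolynomial (Fin (m + 2)) K) :=
  fun i => pderiv_X_of_ne (succ_succ_ne_one i).symm

theorem pderiv (hp : IsBivariate p) (j : Fin (m + 2)) : IsBivariate (pderiv j p) :=
  fun i => by rw [pderiv_comm, hp i, map_zero]

theorem of_mul (hp : IsBivariate p) (hp0 : p ≠ 0) (h : IsBivariate (p * q)) : IsBivariate q :=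
  fun i => by
    have h1 := h i
    rw [pderiv_mul, hp i, zero_mul, zero_add] at h1
    exact (mul_eq_zero.1 h1).resolve_left hp0

end IsBivariate

/-- The derivative of `G` along the vector field `v` in the variables `x_2, …, x_n`. -/
noncomputable def dir (v : Fin (m + 1) → MvPolynomial (Fin (m + 2)) K)
    (G : MvPolynomial (Fin (m + 2)) K) : MvPolynomial (Fin (m + 2)) K :=
  ∑ i, v i * pderiv i.succ G

theorem dir_eq (v : Fin (m + 1) → MvPolynomial (Fin (m + 2)) K)
    (G : MvPolynomial (Fin (m + 2)) K) :
    dir v G = v 0 * pderiv 1 G + ∑ i : Fin m, v i.succ * pderiv i.succ.succ G := by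
  rw [dir, Fin.sum_univ_succ, Fin.succ_zero_eq_one]

theorem IsBivariate.dir_eq {p : MvPolynomial (Fin (m + 2)) K} (hp : IsBivariate p)
    (v : Fin (m + 1) → MvPolynomial (Fin (m + 2)) K) : dir v p = v 0 * MvPolynomial.pderiv 1 p := by
  rw [PolyMap.dir_eq, Finset.sum_eq_zero fun i _ => by rw [hp i, mul_zero], add_zero]

theorem pderiv_dir (j : Fin (m + 2)) (v : Fin (m + 1) → MvPolynomial (Fin (m + 2)) K)
    (G : MvPolynomial (Fin (m + 2)) K) :
    pderiv j (dir v G) = dir (fun i => pderiv j (v i)) G + dir v (pderiv j G) := by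
  simp only [dir, map_sum, pderiv_mul, Finset.sum_add_distrib, pderiv_comm j]

theorem dir_dir (v w : Fin (m + 1) → MvPolynomial (Fin (m + 2)) K)
    (G : MvPolynomial (Fin (m + 2)) K) :
    dir v (dir w G) = dir (fun i => dir v (w i)) G +
      ∑ j, ∑ i, v j * w i * pderiv j.succ (pderiv i.succ G) := by
  have h : ∀ j, v j * pderiv j.succ (dir w G) =
      ∑ i, v j * pderiv j.succ (w i) * pderiv i.succ G +
        ∑ i, v j * w i * pderiv j.succ (pderiv i.succ G) := by
    intro j
    rw [dir, map_sum, Finset.mul_sum, ← Finset.sum_add_distrib]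
    refine Finset.sum_congr rfl fun i _ => ?_
    rw [pderiv_mul]
    ring
  rw [dir, Finset.sum_congr rfl fun j _ => h j, Finset.sum_add_distrib, Finset.sum_comm]
  simp only [dir, Finset.sum_mul]

/-- The second-order parts of the two compositions agree by symmetry of second derivatives. -/
theorem dir_bracket (v w : Fin (m + 1) → MvPolynomial (Fin (m + 2)) K)
    (G : MvPolynomial (Fin (m + 2)) K) :
    dir v (dir w G) - dir w (dir v G) =
      dir (fun i => dir v (w i)) G - dir (fun i => dir w (v i)) G := by
  have h : ∑ j, ∑ i, v j * w i * pderiv j.succ (pderiv i.succ G) =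
      ∑ j, ∑ i, w j * v i * pderiv j.succ (pderiv i.succ G) := by
    rw [Finset.sum_comm]
    exact Finset.sum_congr rfl fun _ _ => Finset.sum_congr rfl fun _ _ => by
      rw [pderiv_comm, mul_comm (v _)]
  rw [dir_dir v w G, dir_dir w v G, h, add_sub_add_right_eq_sub]

/-- The vector fields over `K[x_1, x_2]` along which the derivative of `G` is bivariate. -/
def bivariateFields (G : MvPolynomial (Fin (m + 2)) K) :
    AddSubgroup (Fin (m + 1) → MvPolynomial (Fin (m + 2)) K) where
  carrier := {v | (∀ i, IsBivariate (v i)) ∧ IsBivariate (dir v G)}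
  add_mem' := by
    rintro v w ⟨hv, hv'⟩ ⟨hw, hw'⟩
    refine ⟨fun i => (hv i).add (hw i), ?_⟩
    have : dir (v + w) G = dir v G + dir w G := by
      simp only [dir, Pi.add_apply, add_mul, Finset.sum_add_distrib]
    rw [this]
    exact hv'.add hw'
  zero_mem' := by
    refine ⟨fun i => IsBivariate.zero, ?_⟩
    have : dir 0 G = 0 := by simp [dir]
    rw [this]
    exact IsBivariate.zero
  neg_mem' := by
    rintro v ⟨hv, hv'⟩
    refine ⟨fun i => (hv i).neg, ?_⟩
    have : dir (-v) G = -dir v G := by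
      simp only [dir, Pi.neg_apply, neg_mul, Finset.sum_neg_distrib]
    rw [this]
    exact hv'.neg

variable {G : MvPolynomial (Fin (m + 2)) K} {v w : Fin (m + 1) → MvPolynomial (Fin (m + 2)) K}

theorem smul_mem_bivariateFields {p : MvPolynomial (Fin (m + 2)) K} (hp : IsBivariate p)
    (hv : v ∈ bivariateFields G) : (fun i => p * v i) ∈ bivariateFields G := by
  refine ⟨fun i => hp.mul (hv.1 i), ?_⟩
  have : dir (fun i => p * v i) G = p * dir v G := by
    simp only [dir, Finset.mul_sum, mul_assoc]
  rw [this]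
  exact hp.mul hv.2

theorem pderiv_zero_mem_bivariateFields (hG : IsBivariate (pderiv 0 G))
    (hv : v ∈ bivariateFields G) : (fun i => pderiv 0 (v i)) ∈ bivariateFields G := by
  refine ⟨fun i => (hv.1 i).pderiv 0, ?_⟩
  have : dir (fun i => pderiv 0 (v i)) G = pderiv 0 (dir v G) - dir v (pderiv 0 G) := by
    rw [pderiv_dir]; ring
  rw [this, hG.dir_eq]
  exact (hv.2.pderiv 0).sub ((hv.1 0).mul (hG.pderiv 1))

/-- On bivariate polynomials `dir v` is `v 0 · ∂_2`. So the bracket identity expresses `v 0` times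
the derivative of `G` along `∂_2 w` by bivariate terms, and `v 0` can be cancelled. A single field
`v` with `∂_2 v` admissible thus gives stability under `∂_2` for all `w`. -/
theorem pderiv_one_mem_bivariateFields (hv0 : v 0 ≠ 0) (hv : v ∈ bivariateFields G)
    (hv1 : (fun i => pderiv 1 (v i)) ∈ bivariateFields G)
    (hw : w ∈ bivariateFields G) : (fun i => pderiv 1 (w i)) ∈ bivariateFields G := by
  refine ⟨fun i => (hw.1 i).pderiv 1, (hv.1 0).of_mul hv0 ?_⟩
  have h := dir_bracket v w G
  rw [hw.2.dir_eq, hv.2.dir_eq, funext fun i => (hw.1 i).dir_eq v,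
    funext fun i => (hv.1 i).dir_eq w] at h
  have : v 0 * dir (fun i => pderiv 1 (w i)) G = v 0 * pderiv 1 (dir w G) -
      w 0 * pderiv 1 (dir v G) + w 0 * dir (fun i => pderiv 1 (v i)) G := by
    rw [h]
    simp only [dir, Finset.mul_sum, mul_assoc]
    ring
  rw [this]
  exact (((hv.1 0).mul (hw.2.pderiv 1)).sub ((hw.1 0).mul (hv.2.pderiv 1))).add
    ((hw.1 0).mul hv1.2)

theorem eq_sum_monomial_mul_C {σ ι : Type*} [Fintype ι] (v : ι → MvPolynomial σ K) :
    ∃ T : Finset (σ →₀ ℕ), (∀ s ∉ T, ∀ i, coeff s (v i) = 0) ∧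
      ∀ i, v i = ∑ s ∈ T, monomial s 1 * C (coeff s (v i)) := by
  classical
  refine ⟨Finset.univ.biUnion fun i => (v i).support, fun s hs i => ?_, fun i => ?_⟩
  · by_contra h
    exact hs (Finset.mem_biUnion.2 ⟨i, Finset.mem_univ _, mem_support_iff.2 h⟩)
  · conv_lhs => rw [(v i).as_sum]
    have : ∀ s, monomial s 1 * C (coeff s (v i)) = monomial s (coeff s (v i)) := by
      intro s
      rw [mul_comm, C_mul_monomial, mul_one]
    simp only [this]
    refine Finset.sum_subset (Finset.subset_biUnion_of_mem (fun i => (v i).support)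
      (Finset.mem_univ i)) fun s _ hs => ?_
    rw [notMem_support_iff.1 hs, monomial_zero]

theorem coeff_sum_mul_of_coeff {σ ι : Type*} [Fintype ι] {U G : ι → MvPolynomial σ K}
    {l : (σ →₀ ℕ) → K} (h : ∀ s, ∑ i, C (coeff s (U i)) * G i = C (l s)) (t : σ →₀ ℕ) :
    coeff t (∑ i, U i * G i) = l t := by
  classical
  obtain ⟨T, hT, hU⟩ := eq_sum_monomial_mul_C U
  have h1 : ∑ i, U i * G i = ∑ s ∈ T, monomial s (l s) := by
    have h2 : ∀ i, U i * G i = ∑ s ∈ T, monomial s 1 * (C (coeff s (U i)) * G i) := by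
      intro i
      conv_lhs => rw [hU i]
      simp only [Finset.sum_mul, mul_assoc]
    simp only [h2]
    rw [Finset.sum_comm]
    refine Finset.sum_congr rfl fun s _ => ?_
    rw [← Finset.mul_sum, h s, mul_comm, C_mul_monomial, mul_one]
  rw [h1, coeff_sum]
  simp only [coeff_monomial, Finset.sum_ite_eq']
  split_ifs with ht
  · rfl
  · have h3 := h t
    simp only [hT t ht, C_0, zero_mul, Finset.sum_const_zero] at h3
    exact (C_eq_zero.1 h3.symm).symm

variable [CharZero K]

/-- The coefficient of `s` is read off from a derivative when `s` involves a variable. -/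
theorem C_coeff_mem_of_pderiv (S : AddSubgroup (Fin (m + 1) → MvPolynomial (Fin (m + 2)) K))
    (hC : ∀ (a : K), ∀ v ∈ S, (fun i => C a * v i) ∈ S) (j : Fin (m + 2))
    {s : Fin (m + 2) →₀ ℕ} (hs : s j ≠ 0)
    (h : (fun i => C (coeff (s - Finsupp.single j 1) (pderiv j (v i)))) ∈ S) :
    (fun i => C (coeff s (v i))) ∈ S := by
  have h1 := hC ((s j : K)⁻¹) _ h
  convert h1 using 2 with i
  rw [coeff_pderiv, tsub_add_cancel_of_le (by simpa [Nat.one_le_iff_ne_zero] using hs), ← C_mul]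
  congr 1
  have h2 : (((s - Finsupp.single j 1 : Fin (m + 2) →₀ ℕ) j : ℕ) : K) + 1 = s j := by
    rw [Finsupp.tsub_apply, Finsupp.single_eq_same]
    exact_mod_cast Nat.sub_add_cancel (Nat.one_le_iff_ne_zero.2 hs)
  rw [h2]
  have h3 : (s j : K) ≠ 0 := Nat.cast_ne_zero.2 hs
  field_simp

/-- Induction on a degree bound: a nonconstant coefficient is, up to a nonzero scalar, a coefficient
of a derivative. The constant term is what remains of `v` after the other terms are subtracted. -/
theorem C_coeff_mem_bivariateFields
    (h0 : ∀ v ∈ bivariateFields G, (fun i => pderiv 0 (v i)) ∈ bivariateFields G)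
    (h1 : ∀ v ∈ bivariateFields G, (fun i => pderiv 1 (v i)) ∈ bivariateFields G) (N : ℕ) :
    ∀ v ∈ bivariateFields G, (∀ s : Fin (m + 2) →₀ ℕ, N ≤ s.degree → ∀ i, coeff s (v i) = 0) →
      ∀ s, (fun i => C (coeff s (v i))) ∈ bivariateFields G := by
  induction N with
  | zero =>
    intro v _ hN s
    simp only [hN s (Nat.zero_le _), C_0]
    exact zero_mem _
  | succ N ih =>
    intro v hv hN
    have hd : ∀ j : Fin (m + 2), ∀ s : Fin (m + 2) →₀ ℕ, N ≤ s.degree → ∀ i,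
        coeff s (pderiv j (v i)) = 0 := by
      intro j s hs i
      rw [coeff_pderiv, hN _ (by simpa using hs), zero_mul]
    have hne : ∀ s : Fin (m + 2) →₀ ℕ, s ≠ 0 → (fun i => C (coeff s (v i))) ∈
        bivariateFields G := by
      intro s hs
      obtain ⟨j, hj⟩ := Finsupp.ne_iff.1 hs
      have hmem : (fun i => pderiv j (v i)) ∈ bivariateFields G := by
        induction j using forall_fin_add_two with
        | h0 => exact h0 v hv
        | h1 => exact h1 v hv
        | h j =>
          simp only [hv.1 _ j]
          exact zero_mem _
      exact C_coeff_mem_of_pderiv _ (fun a v hv => smul_mem_bivariateFields (.const a) hv) j hj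
        (ih _ hmem (hd j) _)
    intro s
    by_cases hs : s = 0
    · subst hs
      classical
      obtain ⟨T, hT, hvT⟩ := eq_sum_monomial_mul_C v
      have hterm : ∀ s : Fin (m + 2) →₀ ℕ, s ≠ 0 →
          (fun i => monomial s 1 * C (coeff s (v i))) ∈ bivariateFields G := by
        intro s hs
        by_cases h : ∃ j : Fin m, s j.succ.succ ≠ 0
        · obtain ⟨j, hj⟩ := h
          simp only [coeff_eq_zero_of_pderiv_eq_zero (hv.1 _ j) hj, C_0, mul_zero]
          exact zero_mem _
        · push Not at h
          refine smul_mem_bivariateFields (fun j => ?_) (hne s hs)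
          rw [pderiv_monomial, h j, Nat.cast_zero, mul_zero, monomial_zero]
      have hsum : (∑ s ∈ T.erase 0, fun i => monomial s 1 * C (coeff s (v i))) ∈
          bivariateFields G :=
        sum_mem fun s hs => hterm s (Finset.ne_of_mem_erase hs)
      convert sub_mem hv hsum using 1
      ext1 i
      rw [Pi.sub_apply, Finset.sum_apply, eq_sub_iff_add_eq]
      conv_rhs => rw [hvT i]
      by_cases h0T : (0 : Fin (m + 2) →₀ ℕ) ∈ T
      · rw [← Finset.add_sum_erase T _ h0T]
        congr 1
        rw [show (monomial (0 : Fin (m + 2) →₀ ℕ)) (1 : K) = 1 from rfl, one_mul]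
      · rw [hT 0 h0T i, C_0, zero_add, Finset.erase_eq_of_notMem h0T]
    · exact hne s hs

/-- The field `V` itself need not be admissible, but `∂_1 V` and `∂_2 V` are. As `V` has no constant
term, every coefficient of `V` is visible in one of them. The field required by
`pderiv_one_mem_bivariateFields` is `∂_1 V`. -/
theorem isBivariate_dir_coeff {V : Fin (m + 1) → MvPolynomial (Fin (m + 2)) K}
    (hV : ∀ i, IsBivariate (V i)) (hV0 : ∀ i, coeff 0 (V i) = 0) (hG : IsBivariate (pderiv 0 G))
    (ha : pderiv 0 (V 0) ≠ 0) (h0 : IsBivariate (dir (fun i => pderiv 0 (V i)) G))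
    (h1 : IsBivariate (dir (fun i => pderiv 1 (V i)) G)) (s : Fin (m + 2) →₀ ℕ) :
    IsBivariate (dir (fun i => C (coeff s (V i))) G) := by
  have m0 : (fun i => pderiv 0 (V i)) ∈ bivariateFields G := ⟨fun i => (hV i).pderiv 0, h0⟩
  have m1 : (fun i => pderiv 1 (V i)) ∈ bivariateFields G := ⟨fun i => (hV i).pderiv 1, h1⟩
  have m01 : (fun i => pderiv 1 (pderiv 0 (V i))) ∈ bivariateFields G := by
    simp only [pderiv_comm (1 : Fin (m + 2)) 0]
    exact pderiv_zero_mem_bivariateFields hG m1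
  have hco : ∀ v ∈ bivariateFields G, ∀ s, (fun i => C (coeff s (v i))) ∈ bivariateFields G := by
    intro v hv
    obtain ⟨T, hT, -⟩ := eq_sum_monomial_mul_C v
    refine C_coeff_mem_bivariateFields (fun v hv => pderiv_zero_mem_bivariateFields hG hv)
      (fun w hw => pderiv_one_mem_bivariateFields ha m0 m01 hw) (T.sup Finsupp.degree + 1) v hv ?_
    intro s hs
    refine hT s fun hsT => ?_
    have := Finset.le_sup (f := Finsupp.degree) hsT
    omega
  suffices h : (fun i => C (coeff s (V i))) ∈ bivariateFields G from h.2
  by_cases hs : s = 0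
  · subst hs
    simp only [hV0, C_0]
    exact zero_mem _
  · obtain ⟨j, hj⟩ := Finsupp.ne_iff.1 hs
    have hmem : (fun i => pderiv j (V i)) ∈ bivariateFields G := by
      induction j using forall_fin_add_two with
      | h0 => exact m0
      | h1 => exact m1
      | h j =>
        simp only [hV _ j]
        exact zero_mem _
    exact C_coeff_mem_of_pderiv _ (fun a v hv => smul_mem_bivariateFields (.const a) hv) j hj
      (hco _ hmem _)

/-- Constant directions along which `G` has bivariate derivative give constant derivatives. -/
theorem exists_eq_C_of_isBivariate {G : MvPolynomial (Fin (m + 2)) K} {u c : Fin m → K}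
    (hG : IsBivariate (pderiv 0 G))
    (hZ : IsBivariate (pderiv 1 G + ∑ i, C (u i) * pderiv i.succ.succ G))
    (hc : IsBivariate (∑ i, C (c i) * pderiv i.succ.succ G)) :
    ∃ l, ∑ i, C (c i) * pderiv i.succ.succ G = C l := by
  obtain ⟨D, hD⟩ : ∃ D, D = ∑ i, C (c i) * pderiv i.succ.succ G := ⟨_, rfl⟩
  rw [← hD] at hc ⊢
  have hd : ∀ j, pderiv j D = ∑ i, C (c i) * pderiv i.succ.succ (pderiv j G) := by
    intro j
    simp only [hD, map_sum, pderiv_C_mul, pderiv_comm j]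
  refine eq_C_of_pderiv_eq_zero fun j => ?_
  induction j using forall_fin_add_two with
  | h0 =>
    rw [hd]
    exact Finset.sum_eq_zero fun i _ => by rw [hG i, mul_zero]
  | h1 =>
    -- Differentiating the bivariate polynomial `∂_2 G + ∑ u_j ∂_j G` along `c` gives `∂_2 D + ∑ u_j
    -- ∂_j D = 0`, where the sum vanishes because `D` is bivariate.
    have h1 : ∑ i, C (c i) *
        pderiv i.succ.succ (pderiv 1 G + ∑ j, C (u j) * pderiv j.succ.succ G) = 0 :=
      Finset.sum_eq_zero fun i _ => by rw [hZ i, mul_zero]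
    simp only [map_add, map_sum, pderiv_C_mul, mul_add, Finset.sum_add_distrib] at h1
    rw [← hd] at h1
    have h2 : ∑ i, C (c i) * ∑ j : Fin m, C (u j) * pderiv i.succ.succ (pderiv j.succ.succ G) =
        ∑ j : Fin m, C (u j) * pderiv j.succ.succ D := by
      simp only [hd, Finset.mul_sum]
      rw [Finset.sum_comm]
      exact Finset.sum_congr rfl fun _ _ => Finset.sum_congr rfl fun _ _ => mul_left_comm _ _ _
    rw [h2, Finset.sum_eq_zero (s := Finset.univ) fun j _ => by rw [hc j, mul_zero],
      add_zero] at h1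
    exact h1
  | h j => exact hc j

theorem exists_bivariate_direction {H : Map (m + 2) K} (hform : HasForm H)
    (hzero : ∀ i, MvPolynomial.eval 0 (H i) = 0) (hQ : pderiv 0 (H 1) ≠ 0)
    (e1 : pderiv 0 (H 0) + pderiv 1 (H 1) = 0)
    (e2 : pderiv 1 (H 1) ^ 2 + pderiv 0 (H 1) * pderiv 1 (H 0) +
      ∑ i : Fin m, pderiv i.succ.succ (H 0) * pderiv 0 (H i.succ.succ) = 0)
    (e3 : pderiv 0 (H 1) * ∑ i : Fin m, pderiv i.succ.succ (H 0) * pderiv 1 (H i.succ.succ) =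
      pderiv 1 (H 1) * ∑ i : Fin m, pderiv i.succ.succ (H 0) * pderiv 0 (H i.succ.succ)) :
    ∃ u : Fin m → K, IsBivariate (pderiv 1 (H 0) + ∑ i, C (u i) * pderiv i.succ.succ (H 0)) ∧
      ∀ s, ∃ l, ∑ i, C (coeff s (H i.succ.succ - C (u i) * H 1)) * pderiv i.succ.succ (H 0) =
        C l := by
  have hB : ∀ i, IsBivariate (H (Fin.succ i)) := fun i =>
    isBivariate_of_mem_adjoin (hform _ (Fin.succ_ne_zero i))
  have hB1 : IsBivariate (H 1) := hB 0
  have hc0 : ∀ i, coeff 0 (H i) = 0 := fun i => by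
    rw [← constantCoeff_eq, ← eval_zero]
    exact hzero i
  have hG : IsBivariate (pderiv 0 (H 0)) := by
    rw [eq_neg_of_add_eq_zero_left e1]
    exact (hB1.pderiv 1).neg
  have hsym : ∀ (j : Fin (m + 2)), ∑ i : Fin m, pderiv j (H i.succ.succ) * pderiv i.succ.succ (H 0)
      = ∑ i : Fin m, pderiv i.succ.succ (H 0) * pderiv j (H i.succ.succ) :=
    fun j => Finset.sum_congr rfl fun _ _ => mul_comm _ _
  have hdir := isBivariate_dir_coeff (G := H 0) (V := fun i => H i.succ) hB (fun i => hc0 _) hG hQ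
    (by
      rw [dir_eq, hsym]
      have : pderiv 0 (H (Fin.succ 0)) * pderiv 1 (H 0) +
          ∑ i : Fin m, pderiv i.succ.succ (H 0) * pderiv 0 (H i.succ.succ) =
          -(pderiv 1 (H 1) ^ 2) := by
        rw [Fin.succ_zero_eq_one]; linear_combination e2
      rw [this]
      exact ((hB1.pderiv 1).pow 2).neg)
    (by
      rw [dir_eq, hsym]
      -- Only `∂_1 H_2` times this derivative is known: by `e3` and `e2` it equals `-(∂_2 H_2)³`.
      refine (hB1.pderiv 0).of_mul hQ ?_
      have : pderiv 0 (H 1) * (pderiv 1 (H (Fin.succ 0)) * pderiv 1 (H 0) +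
          ∑ i : Fin m, pderiv i.succ.succ (H 0) * pderiv 1 (H i.succ.succ)) =
          -(pderiv 1 (H 1) ^ 3) := by
        rw [Fin.succ_zero_eq_one]; linear_combination e3 + pderiv 1 (H 1) * e2
      rw [this]
      exact ((hB1.pderiv 1).pow 3).neg)
  simp only [dir_eq, Fin.succ_zero_eq_one] at hdir
  obtain ⟨s₀, hs₀⟩ : ∃ s₀, coeff s₀ (H 1) ≠ 0 := by
    by_contra h
    push Not at h
    refine hQ ?_
    rw [show H 1 = 0 from MvPolynomial.ext _ _ (by simpa using h), map_zero]
  -- A coefficient vector of `(H_2, …, H_n)`, scaled to have `x_2`-component `1`.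
  obtain ⟨u, hu⟩ : ∃ u : Fin m → K, u = fun i =>
    (coeff s₀ (H 1))⁻¹ * coeff s₀ (H i.succ.succ) := ⟨_, rfl⟩
  have hZB : IsBivariate (pderiv 1 (H 0) + ∑ i, C (u i) * pderiv i.succ.succ (H 0)) := by
    have : pderiv 1 (H 0) + ∑ i, C (u i) * pderiv i.succ.succ (H 0) =
        C (coeff s₀ (H 1))⁻¹ * (C (coeff s₀ (H 1)) * pderiv 1 (H 0) +
        ∑ i : Fin m, C (coeff s₀ (H i.succ.succ)) * pderiv i.succ.succ (H 0)) := by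
      rw [hu, mul_add, ← mul_assoc, ← C_mul, inv_mul_cancel₀ hs₀, C_1, one_mul, Finset.mul_sum]
      simp only [C_mul, mul_assoc]
    rw [this]
    exact (IsBivariate.const _).mul (hdir s₀)
  refine ⟨u, hZB, fun s => exists_eq_C_of_isBivariate hG hZB ?_⟩
  have : ∑ i, C (coeff s (H i.succ.succ - C (u i) * H 1)) * pderiv i.succ.succ (H 0) =
      (C (coeff s (H 1)) * pderiv 1 (H 0) +
        ∑ i : Fin m, C (coeff s (H i.succ.succ)) * pderiv i.succ.succ (H 0)) -
      C (coeff s (H 1)) * (pderiv 1 (H 0) + ∑ i, C (u i) * pderiv i.succ.succ (H 0)) := by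
    rw [mul_add, Finset.mul_sum, add_sub_add_left_eq_sub, ← Finset.sum_sub_distrib]
    refine Finset.sum_congr rfl fun i _ => ?_
    rw [coeff_sub, coeff_C_mul, C_sub, C_mul]
    ring
  rw [this]
  exact (hdir s).sub ((IsBivariate.const _).mul hZB)

theorem isBivariate_classification {Q Z S : MvPolynomial (Fin (m + 2)) K} (hQB : IsBivariate Q)
    (hZB : IsBivariate Z) (hSB : IsBivariate S) (hQ : pderiv 0 Q ≠ 0)
    (c1 : pderiv 0 Z = -pderiv 1 (pderiv 1 Q))
    (c2 : pderiv 1 Q ^ 2 + pderiv 0 Q * Z + pderiv 0 S = 0)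
    (c3 : pderiv 0 Q * pderiv 1 S = pderiv 1 Q * pderiv 0 S) :
    ∃ α β μ ν : K, pderiv 1 Q = (C β + C α * X 1) * pderiv 0 Q ∧
      Z = -((C β + C α * X 1) ^ 2 * pderiv 0 Q + C α * Q + C μ) ∧
      S = C (α / 2) * Q ^ 2 + C μ * Q + C ν := by
  obtain ⟨α, β, μ, ν, r1, r2, r3⟩ := bivariate_classification (Q := toBivariate Q)
    (Z := toBivariate Z) (S := toBivariate S)
    (by rw [← toBivariate_pderiv_zero, c1, map_neg, toBivariate_pderiv_one,
      toBivariate_pderiv_one])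
    (by rw [← toBivariate_pderiv_zero, ← toBivariate_pderiv_zero, ← toBivariate_pderiv_one,
      ← map_pow, ← map_mul, ← map_add, ← map_add, c2, map_zero])
    (by rw [← toBivariate_pderiv_zero, ← toBivariate_pderiv_zero, ← toBivariate_pderiv_one,
      ← toBivariate_pderiv_one, ← map_mul, c3, map_mul])
    (by
      rw [← toBivariate_pderiv_zero]
      intro h
      exact hQ ((hQB.pderiv 0).eq_of_toBivariate_eq .zero (by rw [h, map_zero])))
  have hwB : IsBivariate (C β + C α * X 1 : MvPolynomial (Fin (m + 2)) K) :=
    (IsBivariate.const _).add ((IsBivariate.const _).mul .X_one)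
  refine ⟨α, β, μ, ν, ?_, ?_, ?_⟩
  · refine (hQB.pderiv 1).eq_of_toBivariate_eq (hwB.mul (hQB.pderiv 0)) ?_
    rw [toBivariate_pderiv_one, r1]
    simp [toBivariate_pderiv_zero]
  · refine hZB.eq_of_toBivariate_eq ((((hwB.pow 2).mul (hQB.pderiv 0)).add
      ((IsBivariate.const _).mul hQB)).add (.const _)).neg ?_
    rw [r2]
    simp [toBivariate_pderiv_zero]
  · refine hSB.eq_of_toBivariate_eq ((((IsBivariate.const _).mul (hQB.pow 2)).add
      ((IsBivariate.const _).mul hQB)).add (.const _)) ?_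
    rw [r3]
    simp

/-- The equations for a nilpotent Jacobian matrix, solved along suitable constant directions. -/
theorem exists_direction {H : Map (m + 2) K} (hform : HasForm H)
    (hzero : ∀ i, MvPolynomial.eval 0 (H i) = 0) (hQ : pderiv 0 (H 1) ≠ 0)
    (e1 : pderiv 0 (H 0) + pderiv 1 (H 1) = 0)
    (e2 : pderiv 1 (H 1) ^ 2 + pderiv 0 (H 1) * pderiv 1 (H 0) +
      ∑ i : Fin m, pderiv i.succ.succ (H 0) * pderiv 0 (H i.succ.succ) = 0)
    (e3 : pderiv 0 (H 1) * ∑ i : Fin m, pderiv i.succ.succ (H 0) * pderiv 1 (H i.succ.succ) =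
      pderiv 1 (H 1) * ∑ i : Fin m, pderiv i.succ.succ (H 0) * pderiv 0 (H i.succ.succ)) :
    ∃ (α β : K) (u : Fin m → K),
      pderiv 1 (H 1) = (C β + C α * X 1) * pderiv 0 (H 1) ∧
      pderiv 1 (H 0) + ∑ i, C (u i) * pderiv i.succ.succ (H 0) =
        -((C β + C α * X 1) ^ 2 * pderiv 0 (H 1) + C α * H 1) ∧
      ∀ s, ∑ i, C (coeff s (H i.succ.succ - C (u i) * H 1)) * pderiv i.succ.succ (H 0) =
        C (coeff s (C (α / 2) * H 1 ^ 2)) := by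
  have hB : ∀ i, IsBivariate (H (Fin.succ i)) := fun i =>
    isBivariate_of_mem_adjoin (hform _ (Fin.succ_ne_zero i))
  have hB1 : IsBivariate (H 1) := hB 0
  have hG : IsBivariate (pderiv 0 (H 0)) := by
    rw [eq_neg_of_add_eq_zero_left e1]
    exact (hB1.pderiv 1).neg
  obtain ⟨u, hZB, hl⟩ := exists_bivariate_direction hform hzero hQ e1 e2 e3
  obtain ⟨Z, hZ⟩ : ∃ Z, Z = pderiv 1 (H 0) + ∑ i, C (u i) * pderiv i.succ.succ (H 0) := ⟨_, rfl⟩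
  rw [← hZ] at hZB
  obtain ⟨U, hU⟩ : ∃ U : Fin m → MvPolynomial (Fin (m + 2)) K,
    ∀ i, U i = H i.succ.succ - C (u i) * H 1 := ⟨_, fun _ => rfl⟩
  have hUB : ∀ i, IsBivariate (U i) := fun i => by
    rw [hU]
    exact (hB _).sub ((IsBivariate.const _).mul hB1)
  simp only [← hU] at hl
  choose l hl using hl
  obtain ⟨S, hS⟩ : ∃ S, S = ∑ i, U i * pderiv i.succ.succ (H 0) := ⟨_, rfl⟩
  have hSl : ∀ s, coeff s S = l s := fun s => by rw [hS, coeff_sum_mul_of_coeff hl]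
  have hSd : ∀ j, pderiv j S = ∑ i, pderiv j (U i) * pderiv i.succ.succ (H 0) := by
    intro j
    -- Each coefficient vector of `U` differentiates `H_1` to a constant, hence kills `∂_j H_1`.
    have h1 : ∑ i, U i * pderiv j (pderiv i.succ.succ (H 0)) = 0 := by
      ext s
      rw [coeff_zero]
      refine coeff_sum_mul_of_coeff (l := fun _ => 0) (fun s => ?_) s
      have h2 := congrArg (pderiv j) (hl s)
      rw [pderiv_C, map_sum] at h2
      simpa only [pderiv_C_mul, C_0] using h2
    rw [hS, map_sum]
    simp only [pderiv_mul, Finset.sum_add_distrib, h1, add_zero]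
  have hSB : IsBivariate S := fun j => by
    rw [hSd]
    exact Finset.sum_eq_zero fun i _ => by rw [hUB i j, zero_mul]
  have hSd' : ∀ j, pderiv j S = ∑ i : Fin m, pderiv i.succ.succ (H 0) * pderiv j (H i.succ.succ) -
      pderiv j (H 1) * ∑ i, C (u i) * pderiv i.succ.succ (H 0) := by
    intro j
    rw [hSd, Finset.mul_sum, ← Finset.sum_sub_distrib]
    refine Finset.sum_congr rfl fun i _ => ?_
    rw [hU, map_sub, pderiv_C_mul]
    ring
  have c1 : pderiv 0 Z = -pderiv 1 (pderiv 1 (H 1)) := by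
    rw [hZ, map_add, map_sum, Finset.sum_eq_zero, pderiv_comm, eq_neg_of_add_eq_zero_left e1,
      map_neg, add_zero]
    intro i _
    rw [pderiv_C_mul, pderiv_comm, hG i, mul_zero]
  have c2 : pderiv 1 (H 1) ^ 2 + pderiv 0 (H 1) * Z + pderiv 0 S = 0 := by
    rw [hSd', hZ]
    linear_combination e2
  have c3 : pderiv 0 (H 1) * pderiv 1 S = pderiv 1 (H 1) * pderiv 0 S := by
    rw [hSd', hSd']
    linear_combination e3
  obtain ⟨α, β, μ, ν, t1, t2, t3⟩ := isBivariate_classification hB1 hZB hSB hQ c1 c2 c3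
  have hν : ν = 0 := by
    have h1 := congrArg (MvPolynomial.eval 0) t3
    rw [hS] at h1
    simp only [map_sum, map_mul, map_add, map_sub, map_pow, hU, hzero, eval_C] at h1
    simpa using h1.symm
  -- Replacing `u` by `u + u'` turns `Z` into `Z + μ` and `S` into `S - μ Q`, which removes `μ`. A
  -- scaled coefficient vector of `U` serves as `u'`, unless `S = 0`; then `(α/2) Q² + μ Q = 0`
  -- forces `μ = 0`.
  obtain ⟨u', hu'⟩ : ∃ u' : Fin m → K, ∑ i, C (u' i) * pderiv i.succ.succ (H 0) = C μ := by
    by_cases h : ∃ s, l s ≠ 0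
    · obtain ⟨s, hs⟩ := h
      refine ⟨fun i => μ / l s * coeff s (U i), ?_⟩
      simp only [C_mul, mul_assoc, ← Finset.mul_sum, hl]
      rw [← C_mul, div_mul_cancel₀ _ hs]
    · push Not at h
      have hS0 : S = 0 := by
        ext s
        rw [hSl, h, coeff_zero]
      have hH1 : H 1 ≠ 0 := fun h => hQ (by rw [h, map_zero])
      rw [hS0, hν, C_0, add_zero] at t3
      have h1 : C (α / 2) * H 1 + C μ = 0 := by
        have h2 : H 1 * (C (α / 2) * H 1 + C μ) = 0 := by linear_combination -t3
        exact (mul_eq_zero.1 h2).resolve_left hH1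
      have h2 := congrArg (pderiv 0) h1
      rw [map_add, pderiv_C_mul, pderiv_C, add_zero, map_zero] at h2
      rw [(mul_eq_zero.1 h2).resolve_right hQ, zero_mul, zero_add] at h1
      exact ⟨0, by simp [h1]⟩
  refine ⟨α, β, fun i => u i + u' i, t1, ?_, fun s => ?_⟩
  · simp only [C_add, add_mul, Finset.sum_add_distrib]
    rw [← add_assoc, ← hZ, hu', t2]
    ring
  · have h1 : ∀ i : Fin m, coeff s (H i.succ.succ - C (u i + u' i) * H 1) =
        coeff s (U i) - coeff s (H 1) * u' i := by
      intro i
      rw [hU]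
      simp only [coeff_sub, coeff_C_mul]
      ring
    simp only [h1, C_sub, sub_mul, C_mul, mul_assoc, Finset.sum_sub_distrib, ← Finset.mul_sum, hl,
      hu']
    rw [← hSl, t3, hν, C_0, add_zero, coeff_add, coeff_C_mul (a := μ), ← C_mul, ← C_sub]
    congr 1
    ring

end Directions

/-! ### Linear changes of variables that respect the form. -/

section Conjugation

open MvPolynomial

variable {K : Type*} [Field K] {m n : ℕ}

/-- The substitution `p ↦ p(T x)`. -/
noncomputable def linSubst (T : Matrix (Fin n) (Fin n) K) :
    MvPolynomial (Fin n) K →ₐ[K] MvPolynomial (Fin n) K :=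
  aeval (fun l => ∑ s, C (T l s) * X s)

theorem linSubst_X (T : Matrix (Fin n) (Fin n) K) (l : Fin n) :
    linSubst T (X l) = ∑ s, C (T l s) * X s := by
  rw [linSubst, aeval_X]

theorem linSubst_C (T : Matrix (Fin n) (Fin n) K) (a : K) : linSubst T (C a) = C a :=
  (linSubst T).commutes a

theorem sum_C_one_mul (f : Fin n → MvPolynomial (Fin n) K) (i : Fin n) :
    ∑ l, C ((1 : Matrix (Fin n) (Fin n) K) i l) * f l = f i := by
  rw [Finset.sum_eq_single i]
  · rw [Matrix.one_apply_eq, C_1, one_mul]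
  · intro j _ hj
    rw [Matrix.one_apply_ne hj.symm, C_0, zero_mul]
  · simp

theorem sum_C_mul_sum_C_mul (A B : Matrix (Fin n) (Fin n) K) (f : Fin n → MvPolynomial (Fin n) K)
    (i : Fin n) : ∑ j, C (A i j) * ∑ l, C (B j l) * f l = ∑ l, C ((A * B) i l) * f l := by
  simp only [Finset.mul_sum, Matrix.mul_apply, map_sum, Finset.sum_mul, C_mul, mul_assoc]
  exact Finset.sum_comm

theorem linSubst_linSubst {A B : Matrix (Fin n) (Fin n) K} (h : A * B = 1)
    (p : MvPolynomial (Fin n) K) : linSubst B (linSubst A p) = p := by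
  suffices hh : (linSubst B).comp (linSubst A) = AlgHom.id K _ from DFunLike.congr_fun hh p
  refine algHom_ext fun i => ?_
  change linSubst B (linSubst A (X i)) = X i
  rw [linSubst_X, map_sum]
  simp only [map_mul, linSubst_X, linSubst_C]
  rw [sum_C_mul_sum_C_mul, h, sum_C_one_mul]

theorem linSubst_injective (T : Matrix.GeneralLinearGroup (Fin n) K) :
    Function.Injective (linSubst T.val) :=
  Function.LeftInverse.injective (g := linSubst (T⁻¹).val) (linSubst_linSubst T.mul_inv)

theorem pderiv_linSubst (T : Matrix (Fin n) (Fin n) K) (k : Fin n) (p : MvPolynomial (Fin n) K) :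
    pderiv k (linSubst T p) = linSubst T (∑ l, C (T l k) * pderiv l p) := by
  rw [linSubst, pderiv_aeval, map_sum]
  refine Finset.sum_congr rfl fun l _ => ?_
  rw [map_mul, mul_comm, ← linSubst, linSubst_C, map_sum]
  congr 1
  simp only [pderiv_C_mul]
  rw [Finset.sum_eq_single k]
  · rw [pderiv_X_self, mul_one]
  · intro j _ hj
    rw [pderiv_X_of_ne hj, mul_zero]
  · simp

theorem conj_eq_of_forall {T : Matrix.GeneralLinearGroup (Fin n) K} {H G : Map n K}
    (h : ∀ l, linSubst T.val (H l) = ∑ i, C (T.val l i) * G i) : conj T H = G := by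
  ext1 i
  change ∑ j, C ((T⁻¹).val i j) * linSubst T.val (H j) = G i
  simp only [h]
  rw [sum_C_mul_sum_C_mul, T.inv_mul, sum_C_one_mul]

theorem conj_one (H : Map n K) : conj 1 H = H := by
  refine conj_eq_of_forall fun l => ?_
  rw [Units.val_one, sum_C_one_mul]
  have h1 : linSubst (1 : Matrix (Fin n) (Fin n) K) = AlgHom.id K _ :=
    algHom_ext fun i => by rw [linSubst_X, sum_C_one_mul]; rfl
  rw [h1]; rfl

/-- The matrix of a linear change of variables that respects the form of the maps. -/
noncomputable def shearMatrix (s β : K) (u : Fin m → K) (g : Matrix (Fin m) (Fin m) K) :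
    Matrix (Fin (m + 2)) (Fin (m + 2)) K :=
  Matrix.of (Fin.cons (Fin.cons s (Fin.cons (-β) fun _ => 0))
    (Fin.cons (Fin.cons 0 (Fin.cons 1 fun _ => 0))
      fun i => Fin.cons 0 (Fin.cons (u i) fun j => g i j)))

section Entries

variable (s β : K) (u : Fin m → K) (g : Matrix (Fin m) (Fin m) K) (i j : Fin m)

@[simp] theorem shearMatrix_zero_zero : shearMatrix s β u g 0 0 = s := rfl
@[simp] theorem shearMatrix_zero_one : shearMatrix s β u g 0 1 = -β := rfl
@[simp] theorem shearMatrix_zero_succ : shearMatrix s β u g 0 j.succ.succ = 0 := rfl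
@[simp] theorem shearMatrix_one_zero : shearMatrix s β u g 1 0 = 0 := rfl
@[simp] theorem shearMatrix_one_one : shearMatrix s β u g 1 1 = 1 := rfl
@[simp] theorem shearMatrix_one_succ : shearMatrix s β u g 1 j.succ.succ = 0 := rfl
@[simp] theorem shearMatrix_succ_zero : shearMatrix s β u g i.succ.succ 0 = 0 := rfl
@[simp] theorem shearMatrix_succ_one : shearMatrix s β u g i.succ.succ 1 = u i := rfl
@[simp] theorem shearMatrix_succ_succ : shearMatrix s β u g i.succ.succ j.succ.succ = g i j := rfl

end Entries

theorem exists_shear {s : K} (hs : s ≠ 0) (β : K) (u : Fin m → K)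
    (g : Matrix.GeneralLinearGroup (Fin m) K) :
    ∃ T : Matrix.GeneralLinearGroup (Fin (m + 2)) K, T.val = shearMatrix s β u g.val := by
  have h : shearMatrix s β u g.val *
      shearMatrix s⁻¹ (-(s⁻¹ * β)) (fun i => -∑ j, (g⁻¹).val i j * u j) (g⁻¹).val = 1 := by
    ext i j
    rw [Matrix.mul_apply, sum_fin_add_two]
    have hg : ∀ i j, ∑ l, g.val i l * (g⁻¹).val l j = (1 : Matrix (Fin m) (Fin m) K) i j :=
      fun i j => by rw [← g.mul_inv, Matrix.mul_apply]
    have hu : ∀ i, ∑ l, g.val i l * -∑ j, (g⁻¹).val l j * u j = -u i := by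
      intro i
      simp only [mul_neg, Finset.sum_neg_distrib, Finset.mul_sum, ← mul_assoc]
      rw [Finset.sum_comm]
      simp only [← Finset.sum_mul, hg, Matrix.one_apply, ite_mul, one_mul, zero_mul,
        Finset.sum_ite_eq, Finset.mem_univ, if_true]
    induction i using forall_fin_add_two with
    | h0 =>
      induction j using forall_fin_add_two with
      | h0 => simp [hs]
      | h1 => simp [hs]
      | h j => simp [(Fin.succ_ne_zero _).symm]
    | h1 =>
      induction j using forall_fin_add_two with
      | h0 => simp
      | h1 => simp
      | h j => simp [(succ_succ_ne_one j).symm]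
    | h i =>
      induction j using forall_fin_add_two with
      | h0 => simp
      | h1 =>
        rw [Matrix.one_apply_ne (succ_succ_ne_one i)]
        simp only [shearMatrix_succ_zero, shearMatrix_succ_one, shearMatrix_one_one,
          shearMatrix_succ_succ, hu]
        ring
      | h j =>
        simp only [shearMatrix_succ_zero, shearMatrix_one_succ, shearMatrix_succ_succ, hg]
        simp [Matrix.one_apply]
  exact ⟨⟨_, _, h, mul_eq_one_comm.1 h⟩, rfl⟩

/-- The conjugate of `H` by a shear. -/
noncomputable def shearConj (s β : K) (u : Fin m → K) (g : Matrix.GeneralLinearGroup (Fin m) K)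
    (H : Map (m + 2) K) : Map (m + 2) K :=
  Fin.cons (C s⁻¹ * linSubst (shearMatrix s β u g.val) (H 0 + C β * H 1))
    (Fin.cons (linSubst (shearMatrix s β u g.val) (H 1)) fun i =>
      linSubst (shearMatrix s β u g.val)
        (∑ j, C ((g⁻¹).val i j) * (H j.succ.succ - C (u j) * H 1)))

section Shear

variable {s β : K} {u : Fin m → K} {g : Matrix.GeneralLinearGroup (Fin m) K} {H : Map (m + 2) K}

theorem shearConj_zero : shearConj s β u g H 0 =
    C s⁻¹ * linSubst (shearMatrix s β u g.val) (H 0 + C β * H 1) := rfl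

theorem shearConj_one : shearConj s β u g H 1 = linSubst (shearMatrix s β u g.val) (H 1) := rfl

theorem shearConj_succ_succ (i : Fin m) : shearConj s β u g H i.succ.succ =
    linSubst (shearMatrix s β u g.val)
      (∑ j, C ((g⁻¹).val i j) * (H j.succ.succ - C (u j) * H 1)) := rfl

theorem conj_eq_shearConj (hs : s ≠ 0) {T : Matrix.GeneralLinearGroup (Fin (m + 2)) K}
    (hT : T.val = shearMatrix s β u g.val) : conj T H = shearConj s β u g H := by
  refine conj_eq_of_forall fun l => ?_
  rw [hT, sum_fin_add_two, shearConj_zero, shearConj_one]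
  simp only [shearConj_succ_succ]
  induction l using forall_fin_add_two with
  | h0 =>
    simp only [shearMatrix_zero_zero, shearMatrix_zero_one, shearMatrix_zero_succ, C_0, zero_mul,
      Finset.sum_const_zero]
    rw [← mul_assoc, ← C_mul, mul_inv_cancel₀ hs, C_1, C_neg, map_add, map_mul, linSubst_C]
    ring
  | h1 => simp
  | h i =>
    simp only [shearMatrix_succ_zero, shearMatrix_succ_one, shearMatrix_succ_succ, C_0, zero_mul,
      zero_add, map_sum, map_mul, linSubst_C]
    have h1 : ∑ j, C (g.val i j) * ∑ l, C ((g⁻¹).val j l) *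
        linSubst (shearMatrix s β u g.val) (H l.succ.succ - C (u l) * H 1) =
        linSubst (shearMatrix s β u g.val) (H i.succ.succ - C (u i) * H 1) := by
      simp only [Finset.mul_sum, ← mul_assoc, ← C_mul]
      rw [Finset.sum_comm]
      simp only [← Finset.sum_mul, ← map_sum, ← Matrix.mul_apply]
      rw [g.mul_inv, Finset.sum_eq_single i]
      · simp
      · intro j _ hj
        rw [Matrix.one_apply_ne hj.symm, C_0, zero_mul]
      · simp
    rw [h1, map_sub, map_mul, linSubst_C]
    ring

variable (s β u g)

theorem linSubst_shear_X_one : linSubst (shearMatrix s β u g.val) (X 1) = X 1 := by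
  rw [linSubst_X, sum_fin_add_two]
  simp

theorem pderiv_zero_linSubst_shear (p : MvPolynomial (Fin (m + 2)) K) :
    pderiv 0 (linSubst (shearMatrix s β u g.val) p) =
      linSubst (shearMatrix s β u g.val) (C s * pderiv 0 p) := by
  rw [pderiv_linSubst, sum_fin_add_two]
  simp only [shearMatrix_zero_zero, shearMatrix_one_zero, shearMatrix_succ_zero, C_0, zero_mul,
    Finset.sum_const_zero, add_zero]

theorem pderiv_one_linSubst_shear (p : MvPolynomial (Fin (m + 2)) K) :
    pderiv 1 (linSubst (shearMatrix s β u g.val) p) =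
      linSubst (shearMatrix s β u g.val)
        (-(C β * pderiv 0 p) + (pderiv 1 p + ∑ i, C (u i) * pderiv i.succ.succ p)) := by
  rw [pderiv_linSubst, sum_fin_add_two]
  simp only [shearMatrix_zero_one, shearMatrix_one_one, shearMatrix_succ_one, C_neg, C_1, one_mul,
    neg_mul]

theorem pderiv_succ_succ_linSubst_shear (i : Fin m) (p : MvPolynomial (Fin (m + 2)) K) :
    pderiv i.succ.succ (linSubst (shearMatrix s β u g.val) p) =
      linSubst (shearMatrix s β u g.val) (∑ j, C (g.val j i) * pderiv j.succ.succ p) := by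
  rw [pderiv_linSubst, sum_fin_add_two]
  simp only [shearMatrix_zero_succ, shearMatrix_one_succ, shearMatrix_succ_succ, C_0, zero_mul,
    zero_add]

theorem IsBivariate.linSubst_shear {p : MvPolynomial (Fin (m + 2)) K} (hp : IsBivariate p) :
    IsBivariate (linSubst (shearMatrix s β u g.val) p) := fun i => by
  rw [pderiv_succ_succ_linSubst_shear, Finset.sum_eq_zero fun j _ => by rw [hp j, mul_zero],
    map_zero]

theorem hasForm_shearConj [CharZero K] (hB : ∀ i : Fin (m + 1), IsBivariate (H i.succ)) :
    HasForm (shearConj s β u g H) := by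
  intro i hi
  refine mem_adjoin_of_isBivariate ?_
  induction i using forall_fin_add_two with
  | h0 => exact absurd rfl hi
  | h1 => exact (hB 0).linSubst_shear s β u g
  | h i =>
    refine IsBivariate.linSubst_shear s β u g fun l => ?_
    rw [map_sum]
    refine Finset.sum_eq_zero fun j _ => ?_
    rw [pderiv_C_mul, map_sub, pderiv_C_mul, hB j.succ l, ← Fin.succ_zero_eq_one, hB 0 l, mul_zero,
      sub_zero, mul_zero]

end Shear

/-- The constant directions in `x_3, …, x_n` along which `G` does not change. -/
noncomputable def constDirections (G : MvPolynomial (Fin (m + 2)) K) : Submodule K (Fin m → K) where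
  carrier := {c | ∑ i, C (c i) * pderiv i.succ.succ G = 0}
  add_mem' := by
    intro v w hv hw
    simp only [Set.mem_ofPred_eq] at hv hw ⊢
    simp only [Pi.add_apply, C_add, add_mul, Finset.sum_add_distrib, hv, hw, add_zero]
  zero_mem' := by simp
  smul_mem' := by
    intro a v hv
    simp only [Set.mem_ofPred_eq] at hv ⊢
    simp only [Pi.smul_apply, smul_eq_mul, C_mul, mul_assoc, ← Finset.mul_sum, hv, mul_zero]

theorem mem_constDirections {G : MvPolynomial (Fin (m + 2)) K} {c : Fin m → K} :
    c ∈ constDirections G ↔ ∑ i, C (c i) * pderiv i.succ.succ G = 0 := Iff.rfl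

variable [CharZero K]

theorem mem_tailAlg {p : MvPolynomial (Fin n) K} {k : ℕ}
    (h : ∀ i : Fin n, (i : ℕ) < k → pderiv i p = 0) : p ∈ tailAlg K n k := by
  have : {p : MvPolynomial (Fin n) K | ∃ i : Fin n, k ≤ (i : ℕ) ∧ p = X i} =
      X '' {i : Fin n | k ≤ (i : ℕ)} := by
    ext p
    exact ⟨fun ⟨i, hi, h⟩ => ⟨i, hi, h.symm⟩, fun ⟨i, hi, h⟩ => ⟨i, hi, h.symm⟩⟩
  rw [tailAlg, this]
  exact mem_adjoin_X_of_pderiv_eq_zero fun i hi => h i (not_le.1 hi)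

/-- The automorphism `x_1 ↦ x_1 - x_2²` straightens the curves `x_1 + x_2² = const`; by the chain
rule the image of `p` involves `x_1` only. -/
theorem mem_adjoin_parabola {p : MvPolynomial (Fin (m + 2)) K} (hp : IsBivariate p)
    (h : pderiv 1 p = 2 * X 1 * pderiv 0 p) :
    p ∈ Algebra.adjoin K ({X 0 + X 1 ^ 2} : Set (MvPolynomial (Fin (m + 2)) K)) := by
  obtain ⟨f, hf0, hf⟩ : ∃ f : MvPolynomial (Fin (m + 2)) K →ₐ[K] MvPolynomial (Fin (m + 2)) K,
      f (X 0) = X 0 - X 1 ^ 2 ∧ ∀ i, f (X (Fin.succ i)) = X i.succ :=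
    ⟨aeval (Fin.cons (X 0 - X 1 ^ 2) fun i => X i.succ), by rw [aeval_X]; rfl,
      fun i => by rw [aeval_X]; rfl⟩
  obtain ⟨f', hf0', hf'⟩ : ∃ f : MvPolynomial (Fin (m + 2)) K →ₐ[K] MvPolynomial (Fin (m + 2)) K,
      f (X 0) = X 0 + X 1 ^ 2 ∧ ∀ i, f (X (Fin.succ i)) = X i.succ :=
    ⟨aeval (Fin.cons (X 0 + X 1 ^ 2) fun i => X i.succ), by rw [aeval_X]; rfl,
      fun i => by rw [aeval_X]; rfl⟩
  have hinv : f' (f p) = p := by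
    suffices hh : f'.comp f = AlgHom.id K _ from DFunLike.congr_fun hh p
    refine algHom_ext fun i => ?_
    change f' (f (X i)) = X i
    induction i using Fin.cases with
    | zero => rw [hf0, map_sub, map_pow, hf0', ← Fin.succ_zero_eq_one, hf' 0]; ring
    | succ i => rw [hf, hf']
  have hfe : f = aeval (fun i => f (X i)) := algHom_ext fun i => by rw [aeval_X]
  have hd : ∀ i, pderiv i (f p) = ∑ j, f (pderiv j p) * pderiv i (f (X j)) := by
    intro i
    conv_lhs => rw [hfe]
    rw [pderiv_aeval, ← hfe]
  have hmem : f p ∈ Algebra.adjoin K (X '' {0}) := by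
    refine mem_adjoin_X_of_pderiv_eq_zero fun i hi => ?_
    rw [hd, sum_fin_add_two, Finset.sum_eq_zero fun j _ => by rw [hp j, map_zero, zero_mul], hf0,
      ← Fin.succ_zero_eq_one, hf 0, Fin.succ_zero_eq_one, h]
    simp only [map_mul, map_sub, map_ofNat, pderiv_pow]
    rw [← Fin.succ_zero_eq_one, hf 0, Fin.succ_zero_eq_one,
      pderiv_X_of_ne (show (0 : Fin (m + 2)) ≠ i from fun h => hi h.symm)]
    push_cast
    ring
  have h2 := Subalgebra.mem_map.2 ⟨_, hmem, hinv⟩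
  rwa [AlgHom.map_adjoin, Set.image_singleton, Set.image_singleton, hf0'] at h2

end Conjugation

/-! ### The second and third normal forms. -/

section NormalForms

open MvPolynomial

variable {K : Type*} [Field K] {m : ℕ} {H : Map (m + 2) K}

/-- The derivative of `H_1 + β H_2` in the direction of the second coordinate after the shear. -/
theorem sheared_derivative {α β : K} {u : Fin m → K}
    (hB1 : IsBivariate (H 1)) (e1 : pderiv 0 (H 0) + pderiv 1 (H 1) = 0)
    (t1 : pderiv 1 (H 1) = (C β + C α * X 1) * pderiv 0 (H 1))
    (t2 : pderiv 1 (H 0) + ∑ i, C (u i) * pderiv i.succ.succ (H 0) =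
      -((C β + C α * X 1) ^ 2 * pderiv 0 (H 1) + C α * H 1)) :
    -(C β * pderiv 0 (H 0 + C β * H 1)) + (pderiv 1 (H 0 + C β * H 1) +
      ∑ i, C (u i) * pderiv i.succ.succ (H 0 + C β * H 1)) =
      -((C α * X 1) ^ 2 * pderiv 0 (H 1) + C α * H 1) := by
  have h : ∀ i : Fin m, pderiv i.succ.succ (H 0 + C β * H 1) = pderiv i.succ.succ (H 0) := by
    intro i
    rw [map_add, pderiv_C_mul, hB1 i, mul_zero, add_zero]
  simp only [h, map_add, pderiv_C_mul]
  have h0 : pderiv 0 (H 0) = -((C β + C α * X 1) * pderiv 0 (H 1)) := by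
    rw [← t1]; linear_combination e1
  rw [h0, t1]
  linear_combination t2

/-- Constant matrices act on the residual components coefficientwise. -/
theorem sum_C_mul_eq {ι : Type*} [Fintype ι] {U : ι → MvPolynomial (Fin (m + 2)) K} {a : ι → K}
    {p : MvPolynomial (Fin (m + 2)) K} (h : ∀ s, ∑ j, a j * coeff s (U j) = coeff s p) :
    ∑ j, C (a j) * U j = p := by
  ext s
  rw [coeff_sum, ← h s]
  simp only [coeff_C_mul]

variable [CharZero K]

/-- For `α = 0` the shear makes `H_2` free of `x_2`, and `H_1` free of `x_1` and `x_2`. By `t3` all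
coefficient vectors of the residual components lie in `constDirections (H 0)`; in a basis adapted to
this space, `H_1` avoids the variables of the space and the other residual components vanish. -/
theorem exists_normalFormII {β : K} {u : Fin m → K} (hform : HasForm H)
    (hQ : pderiv 0 (H 1) ≠ 0) (e1 : pderiv 0 (H 0) + pderiv 1 (H 1) = 0)
    (t1 : pderiv 1 (H 1) = C β * pderiv 0 (H 1))
    (t2 : pderiv 1 (H 0) + ∑ i, C (u i) * pderiv i.succ.succ (H 0) =
      -(C β ^ 2 * pderiv 0 (H 1)))
    (t3 : ∀ s, ∑ i, C (coeff s (H i.succ.succ - C (u i) * H 1)) * pderiv i.succ.succ (H 0) = 0) :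
    ∃ T : Matrix.GeneralLinearGroup (Fin (m + 2)) K,
      HasForm (conj T H) ∧ NormalFormII (conj T H) := by
  have hB : ∀ i : Fin (m + 1), IsBivariate (H i.succ) := fun i =>
    isBivariate_of_mem_adjoin (hform _ (Fin.succ_ne_zero i))
  have hB1 : IsBivariate (H 1) := hB 0
  have key := sheared_derivative (α := 0) hB1 e1 (by simpa using t1) (by simpa using t2)
  simp only [C_0, zero_mul, ne_eq, OfNat.ofNat_ne_zero, not_false_eq_true, zero_pow, add_zero,
    neg_zero] at key
  obtain ⟨r, hr, g, hg1, hg2⟩ := exists_gl_adapted (constDirections (H 0)) (fun a x ha hx => by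
    simpa [smul_smul, ha] using Submodule.smul_mem _ a⁻¹ hx)
  obtain ⟨T, hT⟩ := exists_shear (one_ne_zero (α := K)) β u g
  refine ⟨T, ?_⟩
  rw [conj_eq_shearConj one_ne_zero hT]
  refine ⟨hasForm_shearConj _ _ _ _ hB, ⟨?_, ?_⟩, r + 2, by omega, by omega, ?_, ?_⟩
  · rw [shearConj_one, ← Set.image_singleton]
    refine mem_adjoin_X_of_pderiv_eq_zero fun i hi => ?_
    induction i using forall_fin_add_two with
    | h0 => simp at hi
    | h1 =>
      rw [pderiv_one_linSubst_shear, t1, Finset.sum_eq_zero fun i _ => by rw [hB1 i, mul_zero],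
        add_zero, neg_add_cancel, map_zero]
    | h i => exact hB1.linSubst_shear _ _ _ _ i
  · intro a ha
    rw [shearConj_one] at ha
    have h1 := congrArg (pderiv 0) ha
    rw [pderiv_zero_linSubst_shear, pderiv_C, C_1, one_mul, ← hT] at h1
    exact hQ (linSubst_injective T (by rw [h1, map_zero]))
  · refine mem_tailAlg fun l hl => ?_
    rw [shearConj_zero, pderiv_C_mul]
    induction l using forall_fin_add_two with
    | h0 =>
      have : pderiv 0 (H 0 + C β * H 1) = 0 := by
        rw [map_add, pderiv_C_mul, ← t1, e1]
      rw [pderiv_zero_linSubst_shear, this, mul_zero, map_zero, mul_zero]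
    | h1 => rw [pderiv_one_linSubst_shear, key, map_zero, mul_zero]
    | h i =>
      have hi : (i : ℕ) < r := by simpa using hl
      have : ∑ j, C (g.val j i) * pderiv j.succ.succ (H 0 + C β * H 1) = 0 := by
        rw [← mem_constDirections.1 (hg1 i hi)]
        refine Finset.sum_congr rfl fun j _ => ?_
        rw [map_add, pderiv_C_mul, hB1 j, mul_zero, add_zero]
      rw [pderiv_succ_succ_linSubst_shear, this, map_zero, mul_zero]
  · intro l hl
    induction l using forall_fin_add_two with
    | h0 => simp at hl
    | h1 => simp at hl
    | h i =>
      rw [shearConj_succ_succ, sum_C_mul_eq (p := 0), map_zero]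
      intro s
      rw [coeff_zero]
      exact hg2 _ (mem_constDirections.2 (t3 s)) i (by simpa using hl)

/-- Modulo `constDirections (H 0)`, the vector of residual components is `H_2² f` with one constant
direction `f` along which `H_1` has derivative `α/2`. Taking `f` as the direction of `x_3` makes
`H_2²` the third component. -/
theorem exists_normalFormIII {α β : K} {u : Fin m → K} (hform : HasForm H) (hα : α ≠ 0)
    (hQ : pderiv 0 (H 1) ≠ 0) (e1 : pderiv 0 (H 0) + pderiv 1 (H 1) = 0)
    (t1 : pderiv 1 (H 1) = (C β + C α * X 1) * pderiv 0 (H 1))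
    (t2 : pderiv 1 (H 0) + ∑ i, C (u i) * pderiv i.succ.succ (H 0) =
      -((C β + C α * X 1) ^ 2 * pderiv 0 (H 1) + C α * H 1))
    (t3 : ∀ s, ∑ i, C (coeff s (H i.succ.succ - C (u i) * H 1)) * pderiv i.succ.succ (H 0) =
      C (coeff s (C (α / 2) * H 1 ^ 2))) :
    ∃ T : Matrix.GeneralLinearGroup (Fin (m + 2)) K,
      HasForm (conj T H) ∧ NormalFormIII (conj T H) := by
  have hB : ∀ i : Fin (m + 1), IsBivariate (H i.succ) := fun i =>
    isBivariate_of_mem_adjoin (hform _ (Fin.succ_ne_zero i))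
  have hB1 : IsBivariate (H 1) := hB 0
  have key := sheared_derivative hB1 e1 t1 t2
  have hs : α / 2 ≠ 0 := div_ne_zero hα two_ne_zero
  have hα2 : (C α : MvPolynomial (Fin (m + 2)) K) = 2 * C (α / 2) := by
    rw [two_mul, ← C_add, add_halves]
  have hinv : (C (α / 2)⁻¹ * C (α / 2) : MvPolynomial (Fin (m + 2)) K) = 1 := by
    rw [← C_mul, inv_mul_cancel₀ hs, C_1]
  obtain ⟨s₀, hs₀⟩ : ∃ s, coeff s (H 1 ^ 2) ≠ 0 := by
    by_contra h
    push Not at h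
    have h1 : H 1 ^ 2 = 0 := MvPolynomial.ext _ _ (by simpa using h)
    exact hQ (by rw [pow_eq_zero_iff two_ne_zero |>.1 h1, map_zero])
  obtain ⟨f, hf⟩ : ∃ f : Fin m → K, ∑ i, C (f i) * pderiv i.succ.succ (H 0) = C (α / 2) := by
    refine ⟨fun i => (coeff s₀ (H 1 ^ 2))⁻¹ * coeff s₀ (H i.succ.succ - C (u i) * H 1), ?_⟩
    simp only [C_mul, mul_assoc, ← Finset.mul_sum]
    rw [t3 s₀, ← C_mul, coeff_C_mul]
    congr 1
    field_simp
  have hfN : f ∉ constDirections (H 0) := by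
    rw [mem_constDirections, hf, C_eq_zero]
    exact hs
  obtain ⟨r, hr, g, hg0, hg1, hg2⟩ := exists_gl_adapted_cons (constDirections (H 0)) hfN
  have hres : ∀ s, (fun i => coeff s (H i.succ.succ - C (u i) * H 1) - coeff s (H 1 ^ 2) * f i) ∈
      constDirections (H 0) := by
    intro s
    rw [mem_constDirections]
    simp only [C_sub, C_mul, sub_mul, mul_assoc, Finset.sum_sub_distrib, ← Finset.mul_sum]
    rw [t3 s, hf, coeff_C_mul, C_mul, mul_comm, sub_self]
  have hcoord : ∀ (i : Fin m), ((i : ℕ) = 0 ∨ r + 1 ≤ (i : ℕ)) → ∀ s,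
      ∑ j, (g⁻¹).val i j * coeff s (H j.succ.succ - C (u j) * H 1) =
        (∑ j, (g⁻¹).val i j * f j) * coeff s (H 1 ^ 2) := by
    intro i hi s
    have h1 := hg2 _ (hres s) i hi
    simp only [mul_sub, Finset.sum_sub_distrib, sub_eq_zero] at h1
    rw [h1, Finset.sum_mul]
    exact Finset.sum_congr rfl fun j _ => by ring
  have hm : 0 < m := by omega
  have hcol : ∀ i : Fin m, ∑ j, (g⁻¹).val i j * f j = if i = ⟨0, hm⟩ then 1 else 0 := by
    intro i
    have h1 := congrFun (congrFun g.inv_mul i) ⟨0, hm⟩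
    rw [Matrix.mul_apply, Matrix.one_apply] at h1
    rw [← h1, ← hg0 ⟨0, hm⟩ rfl]
  -- The scale `s = α/2` turns `∂_2 = α x_2 ∂_1` on `H_2` into `∂_2 = 2 x_2 ∂_1`, and division of
  -- the first component by `s` gives `x_3` the coefficient `1`.
  obtain ⟨T, hT⟩ := exists_shear hs β u g
  refine ⟨T, ?_⟩
  rw [conj_eq_shearConj hs hT]
  have h2 : 2 < m + 2 := by omega
  have hidx : (⟨2, h2⟩ : Fin (m + 2)) = (⟨0, hm⟩ : Fin m).succ.succ := rfl
  -- `k = r + 3` counts `x_1`, `x_2`, the direction `f`, and the `r` directions that do not change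
  -- `H_1`.
  refine ⟨hasForm_shearConj _ _ _ _ hB, ?_, h2, ?_, r + 3, by omega, by omega, ?_, ?_⟩
  · rw [shearConj_one]
    refine mem_adjoin_parabola (hB1.linSubst_shear _ _ _ _) ?_
    rw [pderiv_one_linSubst_shear, pderiv_zero_linSubst_shear, t1,
      Finset.sum_eq_zero fun i _ => by rw [hB1 i, mul_zero]]
    have : -(C β * pderiv 0 (H 1)) + ((C β + C α * X 1) * pderiv 0 (H 1) + 0) =
        C α * (X 1 * pderiv 0 (H 1)) := by ring
    rw [this]
    simp only [map_mul, linSubst_C, linSubst_shear_X_one]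
    rw [hα2]
    ring
  · rw [hidx, shearConj_succ_succ, sum_C_mul_eq (p := H 1 ^ 2), map_pow, shearConj_one]
    intro s
    rw [hcoord _ (Or.inl rfl), hcol, if_pos rfl, one_mul]
  · refine mem_tailAlg fun l hl => ?_
    rw [shearConj_zero, shearConj_one, hidx, map_sub, map_add, pderiv_C_mul, pderiv_mul]
    have hp2 : ∀ i, pderiv i (2 * X 1 : MvPolynomial (Fin (m + 2)) K) = 2 * pderiv i (X 1) := by
      intro i
      rw [show (2 : MvPolynomial (Fin (m + 2)) K) = C 2 from (map_ofNat C 2).symm, pderiv_C_mul]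
    rw [hp2]
    induction l using forall_fin_add_two with
    | h0 =>
      have h0 : pderiv 0 (H 0 + C β * H 1) = -(C α * (X 1 * pderiv 0 (H 1))) := by
        rw [map_add, pderiv_C_mul]
        linear_combination e1 - t1
      rw [pderiv_zero_linSubst_shear, pderiv_zero_linSubst_shear, h0,
        pderiv_X_of_ne (Fin.succ_ne_zero _), pderiv_X_of_ne (by simp)]
      simp only [map_mul, map_neg, linSubst_C, linSubst_shear_X_one]
      linear_combination (-C α * X 1 * linSubst (shearMatrix (α / 2) β u g.val) (pderiv 0 (H 1))) *
        hinv - X 1 * linSubst (shearMatrix (α / 2) β u g.val) (pderiv 0 (H 1)) * hα2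
    | h1 =>
      rw [pderiv_one_linSubst_shear, key, pderiv_one_linSubst_shear, t1,
        Finset.sum_eq_zero fun i _ => by rw [hB1 i, mul_zero], pderiv_X_self,
        pderiv_X_of_ne (succ_succ_ne_one _)]
      have : -(C β * pderiv 0 (H 1)) + ((C β + C α * X 1) * pderiv 0 (H 1) + 0) =
          C α * (X 1 * pderiv 0 (H 1)) := by ring
      rw [this]
      simp only [map_mul, map_neg, map_add, map_pow, linSubst_C, linSubst_shear_X_one]
      rw [hα2]
      set q := linSubst (shearMatrix (α / 2) β u g.val) (H 1)
      set q' := linSubst (shearMatrix (α / 2) β u g.val) (pderiv 0 (H 1))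
      linear_combination (-(4 * C (α / 2) * X 1 ^ 2 * q' + 2 * q)) * hinv
    | h i =>
      have hi : (i : ℕ) < r + 1 := by simpa using hl
      have h0 : ∑ j, C (g.val j i) * pderiv j.succ.succ (H 0 + C β * H 1) =
          ∑ j, C (g.val j i) * pderiv j.succ.succ (H 0) := by
        refine Finset.sum_congr rfl fun j _ => ?_
        rw [map_add, pderiv_C_mul, hB1 j, mul_zero, add_zero]
      rw [pderiv_succ_succ_linSubst_shear, h0, hB1.linSubst_shear,
        pderiv_X_of_ne (succ_succ_ne_one i).symm, pderiv_succ_succ_X_succ_succ]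
      by_cases hi0 : (i : ℕ) = 0
      · have h1 := hg0 i hi0
        have h3 : ∑ j, C (g.val j i) * pderiv j.succ.succ (H 0) = C (α / 2) := by
          rw [← hf, ← h1]
        rw [h3, linSubst_C, hinv, if_pos (Fin.ext hi0)]
        ring
      · rw [mem_constDirections.1 (hg1 i hi0 hi), if_neg fun h => hi0 (congrArg Fin.val h), map_zero]
        ring
  · intro l hl
    induction l using forall_fin_add_two with
    | h0 => simp at hl
    | h1 => simp at hl
    | h i =>
      have hi : r + 1 ≤ (i : ℕ) := by simpa using hl
      rw [shearConj_succ_succ, sum_C_mul_eq (p := 0), map_zero]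
      intro s
      rw [hcoord i (Or.inr hi), hcol, if_neg, zero_mul, coeff_zero]
      intro h
      rw [h] at hi
      simp at hi

end NormalForms

end PolyMap

/-! ### The case distinction. -/

theorem mainTheorem2 {K : Type*} [Field K] [CharZero K] (m : ℕ)
    (H : PolyMap.Map (m + 2) K) (hform : PolyMap.HasForm H)
    (hzero : ∀ i, MvPolynomial.eval 0 (H i) = 0)
    (hnil : IsNilpotent (PolyMap.jacobian H)) :
    ∃ T : Matrix.GeneralLinearGroup (Fin (m + 2)) K,
      PolyMap.HasForm (PolyMap.conj T H) ∧
        (PolyMap.NormalFormI (PolyMap.conj T H) ∨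
          PolyMap.NormalFormII (PolyMap.conj T H) ∨
          PolyMap.NormalFormIII (PolyMap.conj T H)) := by
  have hB : ∀ i : Fin (m + 1), PolyMap.IsBivariate (H i.succ) := fun i =>
    PolyMap.isBivariate_of_mem_adjoin (hform _ (Fin.succ_ne_zero i))
  have hB1 : PolyMap.IsBivariate (H 1) := hB 0
  obtain ⟨e1, e2, e3⟩ := PolyMap.nilpotent_equations hnil (fun j => hB1 j) fun i j => hB i.succ j
  simp only [PolyMap.jacobian, Matrix.of_apply] at e1 e2 e3
  by_cases hQ : MvPolynomial.pderiv 0 (H 1) = 0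
  · rw [hQ, zero_mul, add_zero] at e2
    rw [hQ, zero_mul] at e3
    -- With `∂_1 H_2 = 0`, `e3` says that `∂_2 H_2` or the sum in `e2` vanishes; in the latter case
    -- `e2` gives `(∂_2 H_2)² = 0`.
    have hQy : MvPolynomial.pderiv 1 (H 1) = 0 := by
      rcases mul_eq_zero.1 e3.symm with h | h
      · exact h
      · rw [h, add_zero] at e2
        exact pow_eq_zero_iff two_ne_zero |>.1 e2
    obtain ⟨a, ha⟩ := PolyMap.eq_C_of_pderiv_eq_zero (p := H 1)
      (PolyMap.forall_fin_add_two hQ hQy hB1)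
    have h1 : H 1 = 0 := by
      have h2 := hzero 1
      rw [ha, MvPolynomial.eval_C] at h2
      rw [ha, h2, MvPolynomial.C_0]
    refine ⟨1, ?_⟩
    rw [PolyMap.conj_one]
    refine ⟨hform, Or.inl (PolyMap.normalFormI_of_eq_zero hform h1 ?_ ?_)⟩
    · rwa [hQy, add_zero] at e1
    · rwa [hQy, zero_pow two_ne_zero, zero_add] at e2
  · obtain ⟨α, β, u, t1, t2, t3⟩ := PolyMap.exists_direction hform hzero hQ e1 e2 e3
    by_cases hα : α = 0
    · subst hα
      obtain ⟨T, hT, hT'⟩ := PolyMap.exists_normalFormII hform hQ e1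
        (by simpa using t1) (by simpa using t2) (fun s => by simpa using t3 s)
      exact ⟨T, hT, Or.inr (Or.inl hT')⟩
    · obtain ⟨T, hT, hT'⟩ := PolyMap.exists_normalFormIII hform hα hQ e1 t1 t2 t3
      exact ⟨T, hT, Or.inr (Or.inr hT')⟩
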